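/- **Setting.** Simple types are built from non-functional types $o,\iota,\dots$ by $\to$; the order of a non-functional type is $0$ and $\mathrm{Ord}(\tau_1\to\tau_2)=\max\{\mathrm{Ord}(\tau_1)+1,\mathrm{Ord}(\tau_2)\}$. Terms are $\alpha$-classes of lambda terms $M ::= x\mid c\mid M\,M\mid \lambda x.M\mid \mathrm{fix}\,\lambda x.M$, where a constant $c$ is either non-logical or one of $\top:o$, $\land,\lor,\supset:o\to o\to o$, $\forall_\tau,\exists_\tau:(\tau\to o)\to o$. A signature $\Sigma$ is a partial function from non-logical constants to types; it is *first-order* if each of its constants has type $\iota\to\cdots\to\iota\to\iota$ (function symbol) or $\iota\to\cdots\to\iota\to o$ (predicate). The judgement $\Sigma,\Gamma\vdash M:\tau$ is the usual simple typing, with $\mathrm{fix}\,\lambda x.M:\tau$ if $M:\tau$ for $x:\tau$. $=_{\mathrm{fix}\beta}$ is the congruence generated by $\beta$-reduction and $\mathrm{fix}\,\lambda x.M\to M[x:=\mathrm{fix}\,\lambda x.M]$. Terms are kept in $\beta$-normal form. A *first-order term* is a well-typed $\beta$-normal term of non-functional type, without fixed-point sub-terms and without sub-terms of type $o$, whose constants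 have order at most $1$ and whose variables have order $0$. An *atom* is a term $h\,M_1\dots M_n:o$ with $h$ a variable or a non-logical constant (in the latter case the atom is *rigid*); it is *first-order* if $h$ is a non-logical constant and all $M_i$ are first-order terms. A *guarded fixed-point term* is $\mathrm{fix}\,\lambda x.\lambda y_1\dots y_m.\, f\,L_1\dots L_k\,(x\,N_1\dots N_m)\,L_{k+1}\dots L_r$ with $f:\iota\to\cdots\to\iota\to\iota$ a constant ($r+1$ arguments), $x:\iota\to\cdots\to\iota\to\iota$ ($m$ arguments), and $L_i,N_j:\iota$ first-order terms with $x\notin\{y_1:\iota,\dots,y_m:\iota\}=\bigcup_i FV(L_i)\cup\bigcup_j FV(N_j)$. A *guarded full term* is a first-order term or a term $F\,M_1\dots M_n:\iota$ with $F$ a guarded fixed-point term and $M_i:\iota$ first-order. An atom is *guarded* if it is $=_{\mathrm{fix}\beta}$ to some $h\,M_1\dots M_n:o$ with $h$ a non-logical constant and all $M_i$ guarded full terms. **Calculi.** *Program clauses* $D$ and *goals* $G$ of *co-hohh* are $$D ::= A_r\mid G\supset D\mid D\land D\mid \forall x\,D,\qquad G ::= \top\mid A\mid G\land G\mid G\lor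 G\mid \exists x\,G\mid D\supset G\mid\forall x\,G,$$ with $A$ an atom and $A_r$ a rigid atom not containing $\supset$. In *co-hohc* atoms contain neither $\supset$ nor $\forall$, and the last two forms of goals are omitted; *co-fohc* and *co-fohh* are the restrictions of *co-hohc* and *co-hohh* to first-order atoms. Sequents are $\Sigma;P\looparrowright M$, and $\Sigma;P\longrightarrow G$, $\Sigma;P\stackrel{D}{\longrightarrow}A$ where the right-hand side may carry a mark $\langle\cdot\rangle$. The rules, read from lower to upper sequents, are: * the uniform proof rules: $\supset\!R$ ($D\supset G$: add $D$ to $P$, prove $G$); $\forall R$ ($\forall_\tau x\,G$: prove $G[x:=c]$ over $\Sigma$ extended by $c:\tau$ for a constant $c\notin\mathrm{dom}\,\Sigma$); $\exists R$ ($\exists_\tau x\,G$: prove $G[x:=N]$); $\land R$, $\lor R$, $\top R$; decide ($\Sigma;P\longrightarrow A$ for an atom $A$, from $\Sigma;P\stackrel{D}{\longrightarrow}A$ with $D\in P$); $\supset\!L$ ($\Sigma;P\stackrel{G\supset D}{\longrightarrow}A$ from $\Sigma;P\stackrel{D}{\longrightarrow}A$ and $\Sigma;P\longrightarrow G$); $\land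 L$ (from $\stackrel{D_1\land D_2}{\longrightarrow}A$ to $\stackrel{D_i}{\longrightarrow}A$); $\forall L$ (from $\stackrel{\forall_\tau x\,D}{\longrightarrow}A$ to $\stackrel{D[x:=N]}{\longrightarrow}A$); initial ($\Sigma;P\stackrel{A'}{\longrightarrow}A$ with $A'$ an atom, $A'=_{\mathrm{fix}\beta}A$, or $A'\equiv A$ in *co-fohc* and *co-fohh*). In $\exists R$ and $\forall L$, $N$ is a closed term of type $\tau$ over $\Sigma$ which is first-order in *co-fohc* and *co-fohh*, contains neither $\supset$ nor $\forall$ in *co-hohc*, and does not contain $\supset$ in *co-hohh*; * co-fix: $\Sigma;P\looparrowright M$ from $\Sigma;P,M\longrightarrow\langle M\rangle$; * for marked goals: $\supset\!R\langle\rangle$, $\forall R\langle\rangle$, $\land R\langle\rangle$, $\land L\langle\rangle$, $\forall L\langle\rangle$, initial$\langle\rangle$, which are as above and keep the mark; $\supset\!L\langle\rangle$, which is $\supset\!L$ with the marked $\langle A\rangle$ in the lower sequent and no mark in either upper sequent; and decide$\langle\rangle$, which keeps the mark and whose clause $D$ must belong to the original program, i.e. not be the coinductive hypothesis or a formula added by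 $\supset\!R\langle\rangle$. A *proof* in one of the calculi is a finite tree built by these rules without open leaves, all of whose formulae belong to the language of that calculus (over the signature of their sequent). It *involves only guarded atoms* if all atoms of all formulae of all its sequents, including those below quantifiers, are guarded. **Models.** A *closed tree-term* (*tree-atom*) over a first-order $\Sigma$ is a finite or infinite tree whose nodes are labelled with function symbols of $\Sigma$ (with a predicate of $\Sigma$ at the root), each node having as many children as the arity of its label. $\mathcal H^\Sigma$ and $\mathcal B^\Sigma$ are the sets of all closed tree-terms and tree-atoms. For a guarded atom $A$, $A^T$ is its (possibly infinite) tree, labelled with constants and variables: the limit of the finite first-order parts displayed by the terms to which $A$ reduces. An *$H$-formula* is a program clause of *co-hohc* of the form $\forall_\iota x_1\dots x_m\,(A_1\land\dots\land A_n\supset A)$ with atoms $A_i,A$ and $m,n\ge 0$ (it is $\forall_\iota x_1\dots x_m\,A$ if $n=0$); its *tree-form ground instances* are $(A_1^T\land\dots\land A_n^T\supset A^T)[x_1:=N_1]\cdots[x_m:=N_m]$ with $N_k\in\mathcal H^\Sigma$. A *logic program* over $\Sigma$ is a finite set $P$ of $H$-formulae over $\Sigma$. Its *coinductive model* $\mathcal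 M$ is the greatest fixed point of the operator that maps $I\subseteq\mathcal B^\Sigma$ to the set of those $B\in\mathcal B^\Sigma$ which are the head of a tree-form ground instance, with all body atoms in $I$, of some formula in $P$. **Theorem (Soundness of co-hohh proofs).** Let $\Sigma$ be a first-order signature with $\mathcal H^\Sigma\neq\emptyset$ (equivalently, with at least one function symbol, where symbols of arity $0$ count), let $P$ be a logic program over $\Sigma$ with coinductive model $\mathcal M$, and let $\forall_\iota x_1\dots x_m\,(A_1\land\dots\land A_n\supset A)$ be an $H$-formula over $\Sigma$. Suppose that $\Sigma;P\looparrowright\forall_\iota x_1\dots x_m\,(A_1\land\dots\land A_n\supset A)$ has a proof in *co-hohh* which involves only guarded atoms. Then for every tree-form ground instance $A'_1\land\dots\land A'_n\supset A'$ of this formula, $\{A'_1,\dots,A'_n\}\subseteq\mathcal M$ implies $A'\in\mathcal M$. The same holds for proofs in *co-fohc*, *co-fohh* and *co-hohc*. -/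

import Mathlib

namespace CoUP

universe u

/-! ### Simple types -/

/-- Simple types over the non-functional types `o`, `ι` and further ones. -/
inductive Ty : Type
  | o : Ty
  | iota : Ty
  | base : ℕ → Ty
  | arr : Ty → Ty → Ty

/-- The order of a type. -/
def Ty.order : Ty → ℕ
  | .arr a b => max (a.order + 1) b.order
  | _ => 0

/-- The number of argument types. -/
def Ty.arity : Ty → ℕ
  | .arr _ b => b.arity + 1
  | _ => 0

/-- `arrows [τ₁, …, τₙ] σ` is `τ₁ → ⋯ → τₙ → σ`. -/
def arrows : List Ty → Ty → Ty
  | [], s => s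
  | t :: ts, s => .arr t (arrows ts s)

/-- `ι → ⋯ → ι → σ` with `n` arguments. -/
def iotaArrows (n : ℕ) (s : Ty) : Ty := arrows (List.replicate n .iota) s

/-! ### Terms -/

/-- Logical constants. -/
inductive LogC : Type
  | top : LogC
  | and : LogC
  | or : LogC
  | imp : LogC
  | all : Ty → LogC
  | ex : Ty → LogC

def LogC.ty : LogC → Ty
  | .top => .o
  | .and => .arr .o (.arr .o .o)
  | .or => .arr .o (.arr .o .o)
  | .imp => .arr .o (.arr .o .o)
  | .all t => .arr (.arr t .o) .o
  | .ex t => .arr (.arr t .o) .o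

/-- Lambda terms with a fixed-point binder, up to `α`-equivalence (de Bruijn indices), over the
non-logical constants `C`. The body of `lam M` (that is, `λ x. M`) and of `fix M` (that is,
`fix λ x. M`) has one more variable, of index `0`. Formulae are terms. -/
inductive Tm (C : Type u) : Type u
  | var : ℕ → Tm C
  | con : C → Tm C
  | log : LogC → Tm C
  | app : Tm C → Tm C → Tm C
  | lam : Tm C → Tm C
  | fix : Tm C → Tm C

namespace Tm

variable {C : Type u}

def liftRen (r : ℕ → ℕ) : ℕ → ℕ
  | 0 => 0
  | n + 1 => r n + 1

def rename : (ℕ → ℕ) → Tm C → Tm C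
  | r, var n => var (r n)
  | _, con c => con c
  | _, log l => log l
  | r, app M N => app (rename r M) (rename r N)
  | r, lam M => lam (rename (liftRen r) M)
  | r, fix M => fix (rename (liftRen r) M)

def liftSub (s : ℕ → Tm C) : ℕ → Tm C
  | 0 => var 0
  | n + 1 => rename Nat.succ (s n)

/-- Simultaneous capture-avoiding substitution. -/
def subst : (ℕ → Tm C) → Tm C → Tm C
  | s, var n => s n
  | _, con c => con c
  | _, log l => log l
  | s, app M N => app (subst s M) (subst s N)
  | s, lam M => lam (subst (liftSub s) M)
  | s, fix M => fix (subst (liftSub s) M)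

def instSub (N : Tm C) : ℕ → Tm C
  | 0 => N
  | n + 1 => var n

/-- `M.inst N` is `M[x := N]`, where `x` is the variable of index `0` of the body `M`. -/
def inst (M N : Tm C) : Tm C := subst (instSub N) M

/-- The variable of index `n` occurs free. -/
def Occurs : ℕ → Tm C → Prop
  | n, var k => n = k
  | _, con _ => False
  | _, log _ => False
  | n, app M N => Occurs n M ∨ Occurs n N
  | n, lam M => Occurs (n + 1) M
  | n, fix M => Occurs (n + 1) M

/-- The logical constants that occur in a term. -/
def logs : Tm C → Set LogC
  | var _ => ∅
  | con _ => ∅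
  | log l => {l}
  | app M N => logs M ∪ logs N
  | lam M => logs M
  | fix M => logs M

/-- `M N₁ … Nₙ`. -/
def apps (M : Tm C) (Ns : List (Tm C)) : Tm C := Ns.foldl app M

/-- `λ x₁ … xₙ. M`. -/
def lams (n : ℕ) (M : Tm C) : Tm C := lam^[n] M

/-- The head `h` of `h M₁ … Mₙ`. -/
def head : Tm C → Tm C
  | app M _ => head M
  | M => M

/-- The head is a non-logical constant. -/
def Rigid (A : Tm C) : Prop := ∃ c, A.head = con c

/-- The head is a variable. -/
def Flexible (A : Tm C) : Prop := ∃ x, A.head = var x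

def mkAnd (F G : Tm C) : Tm C := app (app (log .and) F) G
def mkOr (F G : Tm C) : Tm C := app (app (log .or) F) G
def mkImp (F G : Tm C) : Tm C := app (app (log .imp) F) G
def mkAll (t : Ty) (F : Tm C) : Tm C := app (log (.all t)) (lam F)
def mkEx (t : Ty) (F : Tm C) : Tm C := app (log (.ex t)) (lam F)

end Tm

/-! ### Reduction -/

section Reduction

variable {C : Type u}

/-- One step `β`-reduction. -/
inductive Beta : Tm C → Tm C → Prop
  | red (M N : Tm C) : Beta (.app (.lam M) N) (M.inst N)
  | appL {M M' : Tm C} (N : Tm C) : Beta M M' → Beta (.app M N) (.app M' N)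
  | appR (M : Tm C) {N N' : Tm C} : Beta N N' → Beta (.app M N) (.app M N')
  | lam {M M' : Tm C} : Beta M M' → Beta (.lam M) (.lam M')
  | fix {M M' : Tm C} : Beta M M' → Beta (.fix M) (.fix M')

/-- One step `fixβ`-reduction, `fix λ x. M → M[x := fix λ x. M]`. -/
inductive FixStep : Tm C → Tm C → Prop
  | red (M : Tm C) : FixStep (.fix M) (M.inst (.fix M))
  | appL {M M' : Tm C} (N : Tm C) : FixStep M M' → FixStep (.app M N) (.app M' N)
  | appR (M : Tm C) {N N' : Tm C} : FixStep N N' → FixStep (.app M N) (.app M N')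
  | lam {M M' : Tm C} : FixStep M M' → FixStep (.lam M) (.lam M')
  | fix {M M' : Tm C} : FixStep M M' → FixStep (.fix M) (.fix M')

def BetaNormal (M : Tm C) : Prop := ∀ N, ¬ Beta M N

/-- `N` is the `β`-normal form of `M`. -/
def HasBetaNF (M N : Tm C) : Prop := Relation.ReflTransGen Beta M N ∧ BetaNormal N

/-- Reduction by finitely many `β`- and `fixβ`-steps. -/
def Reduces (M N : Tm C) : Prop :=
  Relation.ReflTransGen (fun M N => Beta M N ∨ FixStep M N) M N

/-- The equivalence `=_{fixβ}`. -/
def FixBetaEq (M N : Tm C) : Prop :=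
  Relation.EqvGen (fun M N => Beta M N ∨ FixStep M N) M N

end Reduction

/-! ### Signatures and typing -/

/-- A signature: a partial function from non-logical constants to types. (The logical constants
belong to every signature.) -/
def Sig (C : Type u) : Type u := C → Option Ty

/-- The signature `c : τ, Σ`. -/
noncomputable def Sig.extend {C : Type u} (Sg : Sig C) (c : C) (t : Ty) : Sig C :=
  letI := Classical.decEq C
  Function.update Sg c (some t)

/-- First-order signatures: every non-logical constant has type `ι → ⋯ → ι → τ` with `τ` one of
`ι` (function symbols) and `o` (predicates). -/
def Sig.FirstOrder {C : Type u} (Sg : Sig C) : Prop :=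
  ∀ c t, Sg c = some t → ∃ n, t = iotaArrows n .iota ∨ t = iotaArrows n .o

section Typing

variable {C : Type u}

/-- The typing judgement `Σ, Γ ⊢ M : τ`. -/
inductive HasType (Sg : Sig C) : List Ty → Tm C → Ty → Prop
  | var {Γ : List Ty} {n : ℕ} {t : Ty} : Γ[n]? = some t → HasType Sg Γ (.var n) t
  | con {Γ : List Ty} {c : C} {t : Ty} : Sg c = some t → HasType Sg Γ (.con c) t
  | log {Γ : List Ty} (l : LogC) : HasType Sg Γ (.log l) l.ty
  | app {Γ : List Ty} {M N : Tm C} {a b : Ty} :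
      HasType Sg Γ M (.arr a b) → HasType Sg Γ N a → HasType Sg Γ (.app M N) b
  | lam {Γ : List Ty} {M : Tm C} {a b : Ty} :
      HasType Sg (a :: Γ) M b → HasType Sg Γ (.lam M) (.arr a b)
  | fix {Γ : List Ty} {M : Tm C} {a : Ty} :
      HasType Sg (a :: Γ) M a → HasType Sg Γ (.fix M) a

/-- Well-typed terms built by application from constants of order at most `1` and variables of
order `0`, in which no sub-term has type `o`. -/
inductive FOPart (Sg : Sig C) (Γ : List Ty) : Tm C → Ty → Prop
  | var {n : ℕ} {t : Ty} : Γ[n]? = some t → t.order = 0 → t ≠ .o → FOPart Sg Γ (.var n) t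
  | con {c : C} {t : Ty} : Sg c = some t → t.order ≤ 1 → t ≠ .o → FOPart Sg Γ (.con c) t
  | app {M N : Tm C} {a b : Ty} :
      FOPart Sg Γ M (.arr a b) → FOPart Sg Γ N a → b ≠ .o → FOPart Sg Γ (.app M N) b

/-- First-order (`β`-normal) terms of type `τ` in context `Γ`. (In a `β`-normal term of
non-functional type all of whose constants have order at most `1`, all of whose variables have
order `0` and which contains no fixed-point term, there is no abstraction.) -/
def FirstOrderTm (Sg : Sig C) (Γ : List Ty) (M : Tm C) (t : Ty) : Prop :=
  FOPart Sg Γ M t ∧ t.order = 0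

/-- Atoms: terms of type `o` of the form `h M₁ … Mₙ` with `h` a variable or a non-logical
constant. -/
def Atomic (Sg : Sig C) (Γ : List Ty) (A : Tm C) : Prop :=
  HasType Sg Γ A .o ∧ (A.Rigid ∨ A.Flexible)

/-- First-order atoms. (First-order terms never have type `o` nor a functional type, so `h` is a
first-order predicate.) -/
def FirstOrderAtom (Sg : Sig C) (Γ : List Ty) (A : Tm C) : Prop :=
  ∃ (h : C) (ts : List Ty) (Ms : List (Tm C)), Sg h = some (arrows ts .o) ∧
    List.Forall₂ (FirstOrderTm Sg Γ) Ms ts ∧ A = (Tm.con h).apps Ms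

/-! ### Guarded terms and atoms -/

/-- `F` is a guarded fixed-point term of type `ι → ⋯ → ι → ι` with `m` arguments:
`fix λ x. λ y₁ … yₘ. f L₁ … Lₖ (x N₁ … Nₘ) Lₖ₊₁ … Lᵣ`, where the `Lᵢ`, `Nⱼ` are first-order terms
whose free variables are exactly `y₁, …, yₘ`. Below the binders the `y`s have the indices
`0, …, m - 1` and `x` has index `m`. -/
def GuardedFix (Sg : Sig C) (F : Tm C) (m : ℕ) : Prop :=
  ∃ (f : C) (Ls Ls' Ns : List (Tm C)),
    F = .fix (Tm.lams m ((Tm.con f).apps (Ls ++ [(Tm.var m).apps Ns] ++ Ls'))) ∧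
    Sg f = some (iotaArrows (Ls.length + 1 + Ls'.length) .iota) ∧
    Ns.length = m ∧
    (∀ N ∈ Ls ++ Ls' ++ Ns, FirstOrderTm Sg (List.replicate m .iota) N .iota) ∧
    ∀ j < m, ∃ N ∈ Ls ++ Ls' ++ Ns, N.Occurs j

/-- Guarded full terms: first-order terms, and `F M₁ … Mₙ : ι` with `F` a guarded fixed-point term
and first-order `Mᵢ : ι`. -/
def GuardedFull (Sg : Sig C) (Γ : List Ty) (M : Tm C) (t : Ty) : Prop :=
  FirstOrderTm Sg Γ M t ∨
    t = .iota ∧ ∃ (F : Tm C) (Ms : List (Tm C)), GuardedFix Sg F Ms.length ∧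
      (∀ N ∈ Ms, FirstOrderTm Sg Γ N .iota) ∧ M = F.apps Ms

/-- Guarded atoms: the atoms that are `fixβ`-equivalent to some `h M₁ … Mₙ` with `h` a first-order
predicate and guarded full terms `Mᵢ`. -/
def GuardedAtom (Sg : Sig C) (Γ : List Ty) (A : Tm C) : Prop :=
  Atomic Sg Γ A ∧ ∃ (h : C) (ts : List Ty) (Ms : List (Tm C)), Sg h = some (arrows ts .o) ∧
    List.Forall₂ (GuardedFull Sg Γ) Ms ts ∧ FixBetaEq A ((Tm.con h).apps Ms)

/-! ### The four languages -/

/-- The four calculi. -/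
inductive Calculus : Type
  | cofohc
  | cohohc
  | cofohh
  | cohohh

/-- Hereditary Harrop goals (implications and universal quantifiers) are allowed. -/
def Calculus.Harrop : Calculus → Prop
  | .cofohc => False
  | .cohohc => False
  | .cofohh => True
  | .cohohh => True

/-- Terms without the logical constants `∀` and `⊃`. -/
def InU1 (M : Tm C) : Prop := LogC.imp ∉ M.logs ∧ ∀ t, LogC.all t ∉ M.logs

/-- Terms without the logical constant `⊃`. -/
def InU2 (M : Tm C) : Prop := LogC.imp ∉ M.logs

/-- The (`β`-normal) atoms of each language. -/
def LangAtom (L : Calculus) (Sg : Sig C) (Γ : List Ty) (A : Tm C) : Prop :=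
  Atomic Sg Γ A ∧ BetaNormal A ∧
    match L with
    | .cofohc => FirstOrderAtom Sg Γ A
    | .cofohh => FirstOrderAtom Sg Γ A
    | .cohohc => InU1 A
    | .cohohh => InU2 A

/-- The closed (`β`-normal) terms of type `τ` which may instantiate quantifiers in each calculus. -/
def WitnessTm (L : Calculus) (Sg : Sig C) (N : Tm C) (t : Ty) : Prop :=
  HasType Sg [] N t ∧ BetaNormal N ∧
    match L with
    | .cofohc => FirstOrderTm Sg [] N t
    | .cofohh => FirstOrderTm Sg [] N t
    | .cohohc => InU1 N
    | .cohohh => InU2 N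

mutual

/-- Goal formulae `G`. -/
inductive IsGoal (L : Calculus) (Sg : Sig C) : List Ty → Tm C → Prop
  | top {Γ : List Ty} : IsGoal L Sg Γ (.log .top)
  | atom {Γ : List Ty} {A : Tm C} : LangAtom L Sg Γ A → IsGoal L Sg Γ A
  | and {Γ : List Ty} {G G' : Tm C} : IsGoal L Sg Γ G → IsGoal L Sg Γ G' →
      IsGoal L Sg Γ (G.mkAnd G')
  | or {Γ : List Ty} {G G' : Tm C} : IsGoal L Sg Γ G → IsGoal L Sg Γ G' →
      IsGoal L Sg Γ (G.mkOr G')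
  | ex {Γ : List Ty} {t : Ty} {G : Tm C} : IsGoal L Sg (t :: Γ) G → IsGoal L Sg Γ (.mkEx t G)
  | imp {Γ : List Ty} {D G : Tm C} : L.Harrop → IsClause L Sg Γ D → IsGoal L Sg Γ G →
      IsGoal L Sg Γ (D.mkImp G)
  | all {Γ : List Ty} {t : Ty} {G : Tm C} : L.Harrop → IsGoal L Sg (t :: Γ) G →
      IsGoal L Sg Γ (.mkAll t G)

/-- Program clauses `D`. -/
inductive IsClause (L : Calculus) (Sg : Sig C) : List Ty → Tm C → Prop
  | atom {Γ : List Ty} {A : Tm C} : LangAtom L Sg Γ A → A.Rigid → IsClause L Sg Γ A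
  | imp {Γ : List Ty} {G D : Tm C} : IsGoal L Sg Γ G → IsClause L Sg Γ D →
      IsClause L Sg Γ (G.mkImp D)
  | and {Γ : List Ty} {D D' : Tm C} : IsClause L Sg Γ D → IsClause L Sg Γ D' →
      IsClause L Sg Γ (D.mkAnd D')
  | all {Γ : List Ty} {t : Ty} {D : Tm C} : IsClause L Sg (t :: Γ) D →
      IsClause L Sg Γ (.mkAll t D)

end

/-- Every atom of the formula is guarded. -/
inductive AtomsGuarded (Sg : Sig C) : List Ty → Tm C → Prop
  | top {Γ : List Ty} : AtomsGuarded Sg Γ (.log .top)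
  | atom {Γ : List Ty} {A : Tm C} : GuardedAtom Sg Γ A → AtomsGuarded Sg Γ A
  | and {Γ : List Ty} {F G : Tm C} : AtomsGuarded Sg Γ F → AtomsGuarded Sg Γ G →
      AtomsGuarded Sg Γ (F.mkAnd G)
  | or {Γ : List Ty} {F G : Tm C} : AtomsGuarded Sg Γ F → AtomsGuarded Sg Γ G →
      AtomsGuarded Sg Γ (F.mkOr G)
  | imp {Γ : List Ty} {F G : Tm C} : AtomsGuarded Sg Γ F → AtomsGuarded Sg Γ G →
      AtomsGuarded Sg Γ (F.mkImp G)
  | all {Γ : List Ty} {t : Ty} {F : Tm C} : AtomsGuarded Sg (t :: Γ) F →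
      AtomsGuarded Sg Γ (.mkAll t F)
  | ex {Γ : List Ty} {t : Ty} {F : Tm C} : AtomsGuarded Sg (t :: Γ) F →
      AtomsGuarded Sg Γ (.mkEx t F)

end Typing

/-! ### Sequents and proofs -/

/-- Sequents. The left-hand side of an arrow is `P ∪ H`, where `P` is the original program and `H`
holds the formulae added by the rules (the coinductive hypothesis and those added by `⊃R`). -/
inductive Sequent (C : Type u) : Type u
  /-- `Σ; P ↬ M` -/
  | coind (Sg : Sig C) (P : Set (Tm C)) (M : Tm C)
  /-- `Σ; P, H ⟶ G` -/
  | right (Sg : Sig C) (P H : Set (Tm C)) (G : Tm C)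
  /-- `Σ; P, H ⟶ ⟨M⟩` -/
  | rightG (Sg : Sig C) (P H : Set (Tm C)) (M : Tm C)
  /-- `Σ; P, H ⟶ A` with `D` above the arrow -/
  | left (Sg : Sig C) (P H : Set (Tm C)) (D A : Tm C)
  /-- `Σ; P, H ⟶ ⟨A⟩` with `D` above the arrow -/
  | leftG (Sg : Sig C) (P H : Set (Tm C)) (D A : Tm C)

namespace Sequent

variable {C : Type u}

def sig : Sequent C → Sig C
  | coind Sg _ _ => Sg
  | right Sg _ _ _ => Sg
  | rightG Sg _ _ _ => Sg
  | left Sg _ _ _ _ => Sg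
  | leftG Sg _ _ _ _ => Sg

/-- The formulae to the left of and above the arrow. -/
def clauses : Sequent C → Set (Tm C)
  | coind _ P _ => P
  | right _ P H _ => P ∪ H
  | rightG _ P H _ => P ∪ H
  | left _ P H D _ => insert D (P ∪ H)
  | leftG _ P H D _ => insert D (P ∪ H)

/-- The formula to the right of the arrow. -/
def goal : Sequent C → Tm C
  | coind _ _ M => M
  | right _ _ _ G => G
  | rightG _ _ _ M => M
  | left _ _ _ _ A => A
  | leftG _ _ _ _ A => A

/-- All formulae of the sequent satisfy the syntax of the language `L`. -/
def InLang (L : Calculus) (s : Sequent C) : Prop :=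
  (∀ D ∈ s.clauses, IsClause L s.sig [] D) ∧ IsGoal L s.sig [] s.goal

/-- All atoms of the sequent are guarded. -/
def Guarded (s : Sequent C) : Prop :=
  (∀ D ∈ s.clauses, AtomsGuarded s.sig [] D) ∧ AtomsGuarded s.sig [] s.goal

end Sequent

section Rules

variable {C : Type u}

/-- The comparison of atoms in the rules `initial` and `initial⟨⟩`. -/
def InitialEq (L : Calculus) (A A' : Tm C) : Prop :=
  match L with
  | .cofohc => A = A'
  | .cofohh => A = A'
  | .cohohc => FixBetaEq A A'
  | .cohohh => FixBetaEq A A'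

open Sequent in
/-- `Rule L s ps`: in the calculus `L` there is a rule instance with lower sequent `s` and upper
sequents `ps`. Instances of quantified formulae are brought to `β`-normal form. -/
inductive Rule (L : Calculus) : Sequent C → List (Sequent C) → Prop
  -- uniform proof rules
  | impR (Sg : Sig C) (P H : Set (Tm C)) (D G : Tm C) :
      Rule L (right Sg P H (D.mkImp G)) [right Sg P (insert D H) G]
  | allR (Sg : Sig C) (P H : Set (Tm C)) (t : Ty) (G : Tm C) (c : C) (hc : Sg c = none) :
      Rule L (right Sg P H (.mkAll t G)) [right (Sg.extend c t) P H (G.inst (.con c))]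
  | exR (Sg : Sig C) (P H : Set (Tm C)) (t : Ty) (G N G' : Tm C) (hN : WitnessTm L Sg N t)
      (hG : HasBetaNF (G.inst N) G') :
      Rule L (right Sg P H (.mkEx t G)) [right Sg P H G']
  | orR₁ (Sg : Sig C) (P H : Set (Tm C)) (G₁ G₂ : Tm C) :
      Rule L (right Sg P H (G₁.mkOr G₂)) [right Sg P H G₁]
  | orR₂ (Sg : Sig C) (P H : Set (Tm C)) (G₁ G₂ : Tm C) :
      Rule L (right Sg P H (G₁.mkOr G₂)) [right Sg P H G₂]
  | andR (Sg : Sig C) (P H : Set (Tm C)) (G₁ G₂ : Tm C) :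
      Rule L (right Sg P H (G₁.mkAnd G₂)) [right Sg P H G₁, right Sg P H G₂]
  | impL (Sg : Sig C) (P H : Set (Tm C)) (G D A : Tm C) :
      Rule L (left Sg P H (G.mkImp D) A) [left Sg P H D A, right Sg P H G]
  | andL₁ (Sg : Sig C) (P H : Set (Tm C)) (D₁ D₂ A : Tm C) :
      Rule L (left Sg P H (D₁.mkAnd D₂) A) [left Sg P H D₁ A]
  | andL₂ (Sg : Sig C) (P H : Set (Tm C)) (D₁ D₂ A : Tm C) :
      Rule L (left Sg P H (D₁.mkAnd D₂) A) [left Sg P H D₂ A]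
  | allL (Sg : Sig C) (P H : Set (Tm C)) (t : Ty) (D N D' A : Tm C) (hN : WitnessTm L Sg N t)
      (hD : HasBetaNF (D.inst N) D') :
      Rule L (left Sg P H (.mkAll t D) A) [left Sg P H D' A]
  | decide (Sg : Sig C) (P H : Set (Tm C)) (D A : Tm C) (hA : Atomic Sg [] A) (hD : D ∈ P ∪ H) :
      Rule L (right Sg P H A) [left Sg P H D A]
  | initial (Sg : Sig C) (P H : Set (Tm C)) (A' A : Tm C) (hA : Atomic Sg [] A)
      (hA' : Atomic Sg [] A') (h : InitialEq L A A') :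
      Rule L (left Sg P H A' A) []
  | topR (Sg : Sig C) (P H : Set (Tm C)) :
      Rule L (right Sg P H (.log .top)) []
  -- the coinductive fixed-point rule
  | cofix (Sg : Sig C) (P : Set (Tm C)) (M : Tm C) :
      Rule L (coind Sg P M) [rightG Sg P {M} M]
  -- rules for guarded coinductive goals
  | impRG (Sg : Sig C) (P H : Set (Tm C)) (M₁ M₂ : Tm C) :
      Rule L (rightG Sg P H (M₁.mkImp M₂)) [rightG Sg P (insert M₁ H) M₂]
  | allRG (Sg : Sig C) (P H : Set (Tm C)) (t : Ty) (M : Tm C) (c : C) (hc : Sg c = none) :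
      Rule L (rightG Sg P H (.mkAll t M)) [rightG (Sg.extend c t) P H (M.inst (.con c))]
  | andRG (Sg : Sig C) (P H : Set (Tm C)) (M₁ M₂ : Tm C) :
      Rule L (rightG Sg P H (M₁.mkAnd M₂)) [rightG Sg P H M₁, rightG Sg P H M₂]
  | impLG (Sg : Sig C) (P H : Set (Tm C)) (G D A : Tm C) :
      Rule L (leftG Sg P H (G.mkImp D) A) [left Sg P H D A, right Sg P H G]
  | andLG₁ (Sg : Sig C) (P H : Set (Tm C)) (D₁ D₂ A : Tm C) :
      Rule L (leftG Sg P H (D₁.mkAnd D₂) A) [leftG Sg P H D₁ A]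
  | andLG₂ (Sg : Sig C) (P H : Set (Tm C)) (D₁ D₂ A : Tm C) :
      Rule L (leftG Sg P H (D₁.mkAnd D₂) A) [leftG Sg P H D₂ A]
  | allLG (Sg : Sig C) (P H : Set (Tm C)) (t : Ty) (D N D' A : Tm C) (hN : WitnessTm L Sg N t)
      (hD : HasBetaNF (D.inst N) D') :
      Rule L (leftG Sg P H (.mkAll t D) A) [leftG Sg P H D' A]
  | decideG (Sg : Sig C) (P H : Set (Tm C)) (D A : Tm C) (hA : Atomic Sg [] A) (hD : D ∈ P) :
      Rule L (rightG Sg P H A) [leftG Sg P H D A]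
  | initialG (Sg : Sig C) (P H : Set (Tm C)) (A' A : Tm C) (hA : Atomic Sg [] A)
      (hA' : Atomic Sg [] A') (h : InitialEq L A A') :
      Rule L (leftG Sg P H A' A) []

/-- `ProofIn L Q s`: the sequent `s` has a (finite) proof in the calculus `L`, all of whose formulae
belong to the language of `L` and all of whose sequents have the property `Q`. -/
inductive ProofIn (L : Calculus) (Q : Sequent C → Prop) : Sequent C → Prop
  | node {s : Sequent C} {ps : List (Sequent C)} (rule : Rule L s ps) (lang : s.InLang L)
      (prop : Q s) (premises : ∀ p ∈ ps, ProofIn L Q p) : ProofIn L Q s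

end Rules

/-! ### `H`-formulae and logic programs -/

/-- The data of a formula `∀_ι x₁ … xₘ. A₁ ∧ … ∧ Aₙ ⊃ A`, where `m` is `vars`. In `body` and `head`
the quantified variables have the indices `0, …, m - 1`. -/
structure HForm (C : Type u) : Type u where
  vars : ℕ
  body : List (Tm C)
  head : Tm C

namespace HForm

variable {C : Type u}

/-- `A₁ ∧ (A₂ ∧ (… ∧ Aₙ))`. -/
def conj : Tm C → List (Tm C) → Tm C
  | A, [] => A
  | A, B :: Bs => A.mkAnd (conj B Bs)

/-- `A₁ ∧ … ∧ Aₙ ⊃ A`, which is `A` if `n = 0`. -/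
def matrix (K : HForm C) : Tm C :=
  match K.body with
  | [] => K.head
  | B :: Bs => (conj B Bs).mkImp K.head

def formula (K : HForm C) : Tm C := (Tm.mkAll .iota)^[K.vars] K.matrix

/-- The data describe an `H`-formula over `Σ`: its head is a rigid atom and its body consists of
atoms of the language of *co-hohc*. -/
def IsHFormula (Sg : Sig C) (K : HForm C) : Prop :=
  (LangAtom .cohohc Sg (List.replicate K.vars .iota) K.head ∧ K.head.Rigid) ∧
    ∀ A ∈ K.body, LangAtom .cohohc Sg (List.replicate K.vars .iota) A

end HForm

/-- A logic program over `Σ`: a finite set of `H`-formulae over `Σ`. -/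
def IsLogicProgram {C : Type u} (Sg : Sig C) (P : Set (HForm C)) : Prop :=
  P.Finite ∧ ∀ K ∈ P, K.IsHFormula Sg

/-! ### Trees -/

/-- Labels of trees: non-logical constants and variables. -/
inductive Label (C : Type u) : Type u
  | con : C → Label C
  | var : ℕ → Label C

/-- Labelled trees, as partial functions on finite lists of natural numbers (the root is `[]`, and
`w ++ [i]` is child number `i` of `w`). -/
def LTree (C : Type u) : Type u := List ℕ → Option (Label C)

section Trees

variable {C : Type u}

/-- `t` is a closed, finite or infinite, well-formed tree over the first-order signature `Σ`: its
root is labelled by a constant with target type `τ` and all other nodes by function symbols, the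
domain is closed under prefixes, and the children of a node are numbered `0, …, k - 1` with `k` the
arity of its label. -/
structure IsClosedTree (Sg : Sig C) (t : Ty) (T : LTree C) : Prop where
  root : ∃ c k, T [] = some (.con c) ∧ Sg c = some (iotaArrows k t)
  inner : ∀ w l, w ≠ [] → T w = some l → ∃ c k, l = .con c ∧ Sg c = some (iotaArrows k .iota)
  prefixClosed : ∀ w i, T (w ++ [i]) ≠ none → T w ≠ none
  branching : ∀ w c s, T w = some (.con c) → Sg c = some s →
    ∀ i, T (w ++ [i]) ≠ none ↔ i < s.arity

/-- The coinductive Herbrand universe: all finite and infinite closed tree-terms. -/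
def herbrandUniverse (Sg : Sig C) : Set (LTree C) := {T | IsClosedTree Sg .iota T}

/-- The coinductive Herbrand base: all finite and infinite closed tree-atoms. -/
def herbrandBase (Sg : Sig C) : Set (LTree C) := {T | IsClosedTree Sg .o T}

/-- Substitution of the trees `σ x` for the variables `x` in a tree. -/
def LTree.subst (T : LTree C) (σ : ℕ → LTree C) : LTree C := fun w => go w T
where
  go : List ℕ → LTree C → Option (Label C)
    | w, T =>
      match T [], w with
      | some (.var x), w => σ x w
      | l, [] => l
      | _, i :: w => go w (fun v => T (i :: v))

/-- `Shows M w l`: by reduction, `M` comes to display the label `l` at the node `w`. -/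
inductive Shows : Tm C → List ℕ → Label C → Prop
  | con {M : Tm C} (c : C) (Ms : List (Tm C)) :
      Reduces M ((Tm.con c).apps Ms) → Shows M [] (.con c)
  | var {M : Tm C} (x : ℕ) : Reduces M (.var x) → Shows M [] (.var x)
  | child {M : Tm C} (c : C) (Ms : List (Tm C)) (i : ℕ) (N : Tm C) (w : List ℕ) (l : Label C) :
      Reduces M ((Tm.con c).apps Ms) → Ms[i]? = some N → Shows N w l → Shows M (i :: w) l

open Classical in
/-- The tree `M^T` of a term or atom `M`: the limit of the finite first-order parts displayed by the
reducts of `M`. For a first-order `M` it is `M` read as a tree. -/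
noncomputable def Tm.tree (M : Tm C) : LTree C := fun w =>
  if h : ∃ l, Shows M w l then some h.choose else none

/-! ### The coinductive model -/

/-- `TreeInstance Σ K body' head'`: the set `body'` and the tree `head'` are the body and the head of
a tree-form ground instance `(A₁^T ∧ … ∧ Aₙ^T ⊃ A^T)[x₁ := N₁]…[xₘ := Nₘ]` of the `H`-formula `K`,
with all `Nᵢ` in the coinductive Herbrand universe. -/
def TreeInstance (Sg : Sig C) (K : HForm C) (body' : Set (LTree C)) (head' : LTree C) : Prop :=
  ∃ σ : ℕ → LTree C, (∀ i < K.vars, σ i ∈ herbrandUniverse Sg) ∧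
    body' = {B | ∃ A ∈ K.body, B = A.tree.subst σ} ∧ head' = K.head.tree.subst σ

/-- The immediate consequence operator. -/
def consequence (Sg : Sig C) (P : Set (HForm C)) : Set (LTree C) →o Set (LTree C) where
  toFun I := {B | B ∈ herbrandBase Sg ∧ ∃ K ∈ P, ∃ body', TreeInstance Sg K body' B ∧ body' ⊆ I}
  monotone' := by
    rintro I J hIJ B ⟨hB, K, hK, b, hb, hbI⟩
    exact ⟨hB, K, hK, b, hb, hbI.trans hIJ⟩

/-- The coinductive model: the greatest fixed point of the immediate consequence operator. -/
def coinductiveModel (Sg : Sig C) (P : Set (HForm C)) : Set (LTree C) := (consequence Sg P).gfp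

end Trees

end CoUP

/-!
The proof reads a finite proof of the sequent as a derivation of immediate consequences between
trees and concludes by coinduction.

Reduction is confluent (parallel reduction and complete developments, `Reduces.confluent`), so the
tree of a term depends only on its class under `=_{fixβ}` (`Tm.tree_congr`). A guarded term unfolds
forever into function symbols over guarded terms (`GuardedFull.unfolds`); terms with this property
are called productive (`Productive`), and their trees are total. A witness `N` of a quantifier may
have no total tree, but it matters only where its variable occurs in the tree of an atom, and there
the guardedness of the instantiated atom forces `N` to be productive; elsewhere `N` may be replaced
with an arbitrary closed tree-term, which exists by assumption. Hence taking trees commutes with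
substitution (`EigenExtension.tree_subst_eq_val_of_atom`), and every instance of an `H`-formula in
the proof yields a tree-form ground instance of it (`EigenExtension.treeInstance`). No
standardization theorem is needed, as the trees that are compared are total.

Eigenconstants are evaluated by closed tree-terms (`Tm.val`). Let `J` be a set of tree-atoms which
is closed under the instances of the program clauses and of the coinductive hypothesis `K`. The
unmarked rules only prove atoms with values in `J` (`ProofIn.sound`). The marked rules start from a
clause of the original program, so that they derive the head of each instance of `K` with body in
`J` as an immediate consequence of `J` (`ProofIn.tree_subst_mem_consequence`). If `J` is the least
such set which contains the coinductive model `ℳ`, then `J` is therefore a post-fixed point of the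
consequence operator, so `J ⊆ ℳ`; and the heads of instances of `K` with body in `ℳ` are in `J`.
-/

namespace CoUP

universe u

variable {C : Type u}

/-! ### Substitution -/

namespace Tm

theorem liftRen_comp (r r' : ℕ → ℕ) : liftRen r' ∘ liftRen r = liftRen (r' ∘ r) := by
  funext n; cases n <;> rfl

theorem rename_rename (M : Tm C) (r r' : ℕ → ℕ) :
    rename r' (rename r M) = rename (r' ∘ r) M := by
  induction M generalizing r r' with
  | var n => rfl
  | con c => rfl
  | log l => rfl
  | app M N hM hN => simp [rename, hM, hN]
  | lam M ih => simp [rename, ih, liftRen_comp]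
  | fix M ih => simp [rename, ih, liftRen_comp]

theorem liftSub_comp_liftRen (r : ℕ → ℕ) (s : ℕ → Tm C) :
    liftSub s ∘ liftRen r = liftSub (s ∘ r) := by
  funext n; cases n <;> rfl

theorem subst_rename (M : Tm C) (r : ℕ → ℕ) (s : ℕ → Tm C) :
    subst s (rename r M) = subst (s ∘ r) M := by
  induction M generalizing r s with
  | var n => rfl
  | con c => rfl
  | log l => rfl
  | app M N hM hN => simp [rename, subst, hM, hN]
  | lam M ih => simp [rename, subst, ih, liftSub_comp_liftRen]
  | fix M ih => simp [rename, subst, ih, liftSub_comp_liftRen]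

theorem rename_liftSub (r : ℕ → ℕ) (s : ℕ → Tm C) :
    (fun n => rename (liftRen r) (liftSub s n)) = liftSub (fun n => rename r (s n)) := by
  funext n
  cases n with
  | zero => rfl
  | succ n => simp only [liftSub, rename_rename]; rfl

theorem rename_subst (M : Tm C) (r : ℕ → ℕ) (s : ℕ → Tm C) :
    rename r (subst s M) = subst (fun n => rename r (s n)) M := by
  induction M generalizing r s with
  | var n => rfl
  | con c => rfl
  | log l => rfl
  | app M N hM hN => simp [rename, subst, hM, hN]
  | lam M ih => simp [rename, subst, ih, rename_liftSub]
  | fix M ih => simp [rename, subst, ih, rename_liftSub]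

theorem subst_liftSub (s s' : ℕ → Tm C) :
    (fun n => subst (liftSub s') (liftSub s n)) = liftSub (fun n => subst s' (s n)) := by
  funext n
  cases n with
  | zero => rfl
  | succ n => simp only [liftSub, subst_rename, rename_subst]; rfl

theorem subst_subst (M : Tm C) (s s' : ℕ → Tm C) :
    subst s' (subst s M) = subst (fun n => subst s' (s n)) M := by
  induction M generalizing s s' with
  | var n => rfl
  | con c => rfl
  | log l => rfl
  | app M N hM hN => simp [subst, hM, hN]
  | lam M ih => simp [subst, ih, subst_liftSub]
  | fix M ih => simp [subst, ih, subst_liftSub]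

theorem liftSub_var : liftSub (var : ℕ → Tm C) = var := by
  funext n; cases n <;> rfl

theorem subst_var (M : Tm C) : subst var M = M := by
  induction M with
  | var n => rfl
  | con c => rfl
  | log l => rfl
  | app M N hM hN => simp [subst, hM, hN]
  | lam M ih => simp [subst, ih, liftSub_var]
  | fix M ih => simp [subst, ih, liftSub_var]

theorem rename_eq_subst (M : Tm C) (r : ℕ → ℕ) : rename r M = subst (fun n => var (r n)) M := by
  conv_lhs => rw [← subst_var M, rename_subst]
  rfl

theorem inst_subst (M N : Tm C) (s : ℕ → Tm C) :
    (M.inst N).subst s = (M.subst (liftSub s)).inst (N.subst s) := by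
  simp only [inst, subst_subst]
  congr 1
  funext n
  cases n with
  | zero => rfl
  | succ n =>
    simp only [instSub, liftSub, subst_rename]
    exact (subst_var _).symm

theorem liftSub_var_comp (r : ℕ → ℕ) :
    liftSub (fun n => (var (r n) : Tm C)) = fun n => var (liftRen r n) := by
  funext n; cases n <;> rfl

theorem rename_inst (M N : Tm C) (r : ℕ → ℕ) :
    (M.inst N).rename r = (M.rename (liftRen r)).inst (N.rename r) := by
  rw [rename_eq_subst, inst_subst, liftSub_var_comp, ← rename_eq_subst, ← rename_eq_subst]

/-- The substitution `0 ↦ N`, `n + 1 ↦ s n`. -/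
def scons (N : Tm C) (s : ℕ → Tm C) : ℕ → Tm C
  | 0 => N
  | n + 1 => s n

theorem subst_liftSub_inst (s : ℕ → Tm C) (N : Tm C) :
    (fun n => subst (instSub N) (liftSub s n)) = scons N s := by
  funext n
  cases n with
  | zero => rfl
  | succ n =>
    simp only [liftSub, subst_rename, scons]
    exact subst_var _

theorem subst_iterate_liftSub (k : ℕ) (s s' : ℕ → Tm C) :
    (fun n => subst (liftSub^[k] s') (liftSub^[k] s n)) =
      liftSub^[k] (fun n => subst s' (s n)) := by
  induction k generalizing s s' with
  | zero => rfl
  | succ k ih => simp only [Function.iterate_succ_apply, ih, subst_liftSub]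

theorem iterate_liftSub_var (k : ℕ) : liftSub^[k] (var : ℕ → Tm C) = var := by
  induction k with
  | zero => rfl
  | succ k ih => rw [Function.iterate_succ_apply, liftSub_var, ih]

theorem iterate_liftSub_of_lt {k n : ℕ} (h : n < k) (s : ℕ → Tm C) :
    liftSub^[k] s n = var n := by
  induction k generalizing n with
  | zero => omega
  | succ k ih =>
    rw [Function.iterate_succ_apply']
    cases n with
    | zero => rfl
    | succ n => simp only [liftSub, ih (Nat.lt_of_succ_lt_succ h)]; rfl

theorem iterate_liftSub_add (k n : ℕ) (s : ℕ → Tm C) :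
    liftSub^[k] s (k + n) = rename (k + ·) (s n) := by
  induction k with
  | zero =>
    have : (fun n => 0 + n) = (id : ℕ → ℕ) := by funext n; simp
    simp only [Function.iterate_zero, id, Nat.zero_add]
    rw [rename_eq_subst]; exact (subst_var _).symm
  | succ k ih =>
    rw [Function.iterate_succ_apply', Nat.succ_add]
    simp only [liftSub, ih, rename_rename]
    congr 1
    funext i
    simp only [Function.comp]; omega

/-- Instantiating the outermost of `k + 1` bound variables after a substitution. -/
theorem subst_iterate_inst (k : ℕ) (M N : Tm C) (s : ℕ → Tm C) :
    (M.subst (liftSub^[k + 1] s)).subst (liftSub^[k] (instSub N)) =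
      M.subst (liftSub^[k] (scons N s)) := by
  rw [subst_subst, Function.iterate_succ_apply, subst_iterate_liftSub, subst_liftSub_inst]

theorem subst_lams (n : ℕ) (M : Tm C) (s : ℕ → Tm C) :
    (lams n M).subst s = lams n (M.subst (liftSub^[n] s)) := by
  unfold lams
  induction n generalizing s with
  | zero => rfl
  | succ n ih => simp only [Function.iterate_succ_apply', subst, ih, ← Function.iterate_succ_apply]

theorem subst_mkAlls (t : Ty) (n : ℕ) (M : Tm C) (s : ℕ → Tm C) :
    ((mkAll t)^[n] M).subst s = (mkAll t)^[n] (M.subst (liftSub^[n] s)) := by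
  induction n generalizing s with
  | zero => rfl
  | succ n ih =>
    simp only [Function.iterate_succ_apply', mkAll, subst] at ih ⊢
    rw [← Function.iterate_succ_apply' liftSub, Function.iterate_succ_apply, ← ih]

theorem apps_cons (M N : Tm C) (Ns : List (Tm C)) : M.apps (N :: Ns) = (app M N).apps Ns := rfl

theorem apps_append_singleton (M N : Tm C) (Ns : List (Tm C)) :
    M.apps (Ns ++ [N]) = app (M.apps Ns) N := by
  simp [apps]

theorem subst_apps (M : Tm C) (Ns : List (Tm C)) (s : ℕ → Tm C) :
    (M.apps Ns).subst s = (M.subst s).apps (Ns.map (subst s)) := by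
  induction Ns generalizing M with
  | nil => rfl
  | cons N Ns ih => simp only [apps_cons, ih, List.map_cons, subst]

theorem head_apps (M : Tm C) (Ns : List (Tm C)) : (M.apps Ns).head = M.head := by
  induction Ns generalizing M with
  | nil => rfl
  | cons N Ns ih => rw [apps_cons, ih]; rfl

theorem exists_apps_of_head_eq_con {c : C} :
    ∀ {M : Tm C}, M.head = con c → ∃ Ns, M = (con c).apps Ns
  | var _, h => nomatch h
  | con _, h => ⟨[], h⟩
  | log _, h => nomatch h
  | lam _, h => nomatch h
  | fix _, h => nomatch h
  | app M N, h => by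
    obtain ⟨Ns, rfl⟩ := exists_apps_of_head_eq_con (M := M) h
    exact ⟨Ns ++ [N], (apps_append_singleton _ _ _).symm⟩

theorem apps_con_injective {c d : C} {Ms Ns : List (Tm C)}
    (h : (con c).apps Ms = (con d).apps Ns) : c = d ∧ Ms = Ns := by
  induction Ms using List.reverseRecOn generalizing Ns with
  | nil =>
    rcases List.eq_nil_or_concat Ns with rfl | ⟨Ns, N, rfl⟩
    · exact ⟨Tm.con.inj h, rfl⟩
    · rw [List.concat_eq_append, apps_append_singleton] at h; cases h
  | append_singleton Ms M ih =>
    rcases List.eq_nil_or_concat Ns with rfl | ⟨Ns, N, rfl⟩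
    · rw [apps_append_singleton] at h; cases h
    · rw [List.concat_eq_append, apps_append_singleton, apps_append_singleton] at h
      injection h with h₁ h₂
      obtain ⟨rfl, rfl⟩ := ih h₁
      exact ⟨rfl, by rw [h₂, List.concat_eq_append]⟩

theorem Rigid.subst {A : Tm C} (h : A.Rigid) (s : ℕ → Tm C) : (A.subst s).Rigid := by
  obtain ⟨c, hc⟩ := h
  obtain ⟨Ns, rfl⟩ := exists_apps_of_head_eq_con hc
  exact ⟨c, by rw [subst_apps, head_apps]; rfl⟩

end Tm

/-! ### Confluence -/

theorem forall₂_trans {α : Type*} {R : α → α → Prop} (hR : ∀ a b c, R a b → R b c → R a c)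
    {l₁ l₂ l₃ : List α} (h : List.Forall₂ R l₁ l₂) (h' : List.Forall₂ R l₂ l₃) :
    List.Forall₂ R l₁ l₃ := by
  induction h generalizing l₃ with
  | nil => exact h'
  | cons hab _ ih =>
    cases h' with
    | cons hbc h' => exact .cons (hR _ _ _ hab hbc) (ih h')

/-- One step of `β`- or `fixβ`-reduction. -/
def Step (M N : Tm C) : Prop := Beta M N ∨ FixStep M N

theorem Step.appL {M M' : Tm C} (N : Tm C) (h : Step M M') : Step (.app M N) (.app M' N) :=
  h.imp (.appL N) (.appL N)

theorem Step.appR (M : Tm C) {N N' : Tm C} (h : Step N N') : Step (.app M N) (.app M N') :=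
  h.imp (.appR M) (.appR M)

theorem Step.lam {M M' : Tm C} (h : Step M M') : Step (.lam M) (.lam M') :=
  h.imp .lam .lam

theorem Step.fix {M M' : Tm C} (h : Step M M') : Step (.fix M) (.fix M') :=
  h.imp .fix .fix

theorem Reduces.refl (M : Tm C) : Reduces M M := Relation.ReflTransGen.refl

theorem Reduces.trans {M N R : Tm C} (h : Reduces M N) (h' : Reduces N R) : Reduces M R :=
  Relation.ReflTransGen.trans h h'

theorem Step.reduces {M N : Tm C} (h : Step M N) : Reduces M N := Relation.ReflTransGen.single h

theorem Reduces.app {M M' N N' : Tm C} (h : Reduces M M') (h' : Reduces N N') :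
    Reduces (.app M N) (.app M' N') :=
  (Relation.ReflTransGen.lift (fun M => Tm.app M N) (fun _ _ => Step.appL N) _ _ h).trans
    (Relation.ReflTransGen.lift (fun N => Tm.app M' N) (fun _ _ => Step.appR M') _ _ h')

theorem Reduces.lam {M M' : Tm C} (h : Reduces M M') : Reduces (.lam M) (.lam M') :=
  Relation.ReflTransGen.lift Tm.lam (fun _ _ => Step.lam) _ _ h

theorem Reduces.fix {M M' : Tm C} (h : Reduces M M') : Reduces (.fix M) (.fix M') :=
  Relation.ReflTransGen.lift Tm.fix (fun _ _ => Step.fix) _ _ h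

theorem Reduces.apps {M M' : Tm C} (Ns : List (Tm C)) (h : Reduces M M') :
    Reduces (M.apps Ns) (M'.apps Ns) := by
  induction Ns generalizing M M' with
  | nil => exact h
  | cons N Ns ih => exact ih (h.app (.refl N))

theorem Reduces.of_beta {M N : Tm C} (h : Relation.ReflTransGen Beta M N) : Reduces M N :=
  Relation.ReflTransGen.mono (fun _ _ => Or.inl) _ _ h

theorem Beta.subst {M N : Tm C} (h : Beta M N) : ∀ s, Beta (M.subst s) (N.subst s) := by
  induction h with
  | red M N => intro s; rw [Tm.inst_subst]; exact .red _ _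
  | appL N _ ih => exact fun s => .appL _ (ih s)
  | appR M _ ih => exact fun s => .appR _ (ih s)
  | lam _ ih => exact fun s => .lam (ih _)
  | fix _ ih => exact fun s => .fix (ih _)

theorem FixStep.subst {M N : Tm C} (h : FixStep M N) : ∀ s, FixStep (M.subst s) (N.subst s) := by
  induction h with
  | red M => intro s; rw [Tm.inst_subst]; exact .red _
  | appL N _ ih => exact fun s => .appL _ (ih s)
  | appR M _ ih => exact fun s => .appR _ (ih s)
  | lam _ ih => exact fun s => .lam (ih _)
  | fix _ ih => exact fun s => .fix (ih _)

theorem Reduces.subst {M N : Tm C} (h : Reduces M N) (s : ℕ → Tm C) :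
    Reduces (M.subst s) (N.subst s) :=
  Relation.ReflTransGen.lift (Tm.subst s) (fun _ _ h => h.imp (·.subst s) (·.subst s)) _ _ h

/-- Parallel reduction. -/
inductive Par : Tm C → Tm C → Prop
  | var (n : ℕ) : Par (.var n) (.var n)
  | con (c : C) : Par (.con c) (.con c)
  | log (l : LogC) : Par (.log l) (.log l)
  | app {M M' N N' : Tm C} : Par M M' → Par N N' → Par (.app M N) (.app M' N')
  | lam {M M' : Tm C} : Par M M' → Par (.lam M) (.lam M')
  | fix {M M' : Tm C} : Par M M' → Par (.fix M) (.fix M')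
  | beta {M M' N N' : Tm C} : Par M M' → Par N N' → Par (.app (.lam M) N) (M'.inst N')
  | unfold {M M' : Tm C} : Par M M' → Par (.fix M) (M'.inst (.fix M'))

theorem Par.refl (M : Tm C) : Par M M := by
  induction M with
  | var n => exact .var n
  | con c => exact .con c
  | log l => exact .log l
  | app M N hM hN => exact .app hM hN
  | lam M ih => exact .lam ih
  | fix M ih => exact .fix ih

theorem Par.of_step {M N : Tm C} (h : Step M N) : Par M N := by
  rcases h with h | h
  · induction h with
    | red M N => exact .beta (.refl M) (.refl N)
    | appL N _ ih => exact .app ih (.refl N)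
    | appR M _ ih => exact .app (.refl M) ih
    | lam _ ih => exact .lam ih
    | fix _ ih => exact .fix ih
  · induction h with
    | red M => exact .unfold (.refl M)
    | appL N _ ih => exact .app ih (.refl N)
    | appR M _ ih => exact .app (.refl M) ih
    | lam _ ih => exact .lam ih
    | fix _ ih => exact .fix ih

theorem Par.reduces {M N : Tm C} (h : Par M N) : Reduces M N := by
  induction h with
  | var n => exact .refl _
  | con c => exact .refl _
  | log l => exact .refl _
  | app _ _ h h' => exact h.app h'
  | lam _ h => exact h.lam
  | fix _ h => exact h.fix
  | beta _ _ h h' => exact (h.lam.app h').trans (Step.reduces (.inl (.red _ _)))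
  | unfold _ h => exact h.fix.trans (Step.reduces (.inr (.red _)))

theorem Par.subst {M N : Tm C} (h : Par M N) :
    ∀ {s s' : ℕ → Tm C}, (∀ n, Par (s n) (s' n)) → Par (M.subst s) (N.subst s') := by
  have ren : ∀ {M N : Tm C}, Par M N → ∀ r : ℕ → ℕ, Par (M.rename r) (N.rename r) := by
    intro M N h
    induction h with
    | var n => exact fun r => .var _
    | con c => exact fun r => .con c
    | log l => exact fun r => .log l
    | app _ _ h h' => exact fun r => .app (h r) (h' r)
    | lam _ h => exact fun r => .lam (h _)
    | fix _ h => exact fun r => .fix (h _)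
    | beta _ _ h h' =>
      intro r
      rw [Tm.rename_inst]
      exact .beta (h _) (h' r)
    | unfold _ h =>
      intro r
      rw [Tm.rename_inst]
      exact .unfold (h _)
  have lift : ∀ {s s' : ℕ → Tm C}, (∀ n, Par (s n) (s' n)) →
      ∀ n, Par (Tm.liftSub s n) (Tm.liftSub s' n) := by
    intro s s' hs n
    cases n with
    | zero => exact .var 0
    | succ n => exact ren (hs n) _
  induction h with
  | var n => exact fun hs => hs n
  | con c => exact fun _ => .con c
  | log l => exact fun _ => .log l
  | app _ _ h h' => exact fun hs => .app (h hs) (h' hs)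
  | lam _ h => exact fun hs => .lam (h (lift hs))
  | fix _ h => exact fun hs => .fix (h (lift hs))
  | beta _ _ h h' =>
    intro s s' hs
    rw [Tm.inst_subst]
    exact .beta (h (lift hs)) (h' hs)
  | unfold _ h =>
    intro s s' hs
    rw [Tm.inst_subst]
    exact .unfold (h (lift hs))

theorem Par.inst {M M' N N' : Tm C} (h : Par M M') (h' : Par N N') :
    Par (M.inst N) (M'.inst N') :=
  h.subst fun n => by
    cases n with
    | zero => exact h'
    | succ n => exact .var n

/-- The complete development of a term: all redexes are contracted simultaneously. -/
def Tm.develop : Tm C → Tm C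
  | .var n => .var n
  | .con c => .con c
  | .log l => .log l
  | .app (.lam M) N => M.develop.inst N.develop
  | .app M N => .app M.develop N.develop
  | .lam M => .lam M.develop
  | .fix M => M.develop.inst (.fix M.develop)

/-- The triangle property, which implies that parallel reduction has the diamond property. -/
theorem Par.develop {M N : Tm C} (h : Par M N) : Par N M.develop := by
  induction h with
  | var n => exact .var n
  | con c => exact .con c
  | log l => exact .log l
  | @app M M' N N' hM _ h h' =>
    cases M with
    | lam M =>
      cases hM with
      | lam hM =>
        cases h with
        | lam h => exact .beta h h'
    | _ => exact .app h h'
  | lam _ h => exact .lam h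
  | fix _ h => exact .unfold h
  | beta _ _ h h' => exact h.inst h'
  | unfold _ h => exact h.inst (.fix h)

theorem Reduces.confluent {M N R : Tm C} (h : Reduces M N) (h' : Reduces M R) :
    ∃ S, Reduces N S ∧ Reduces R S := by
  have key : ∀ {M N : Tm C}, Reduces M N → Relation.ReflTransGen Par M N := fun h =>
    Relation.ReflTransGen.mono (fun _ _ => Par.of_step) _ _ h
  have back : ∀ {M N : Tm C}, Relation.ReflTransGen Par M N → Reduces M N := fun h => by
    induction h with
    | refl => exact .refl _
    | tail _ h ih => exact ih.trans h.reduces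
  obtain ⟨S, hS, hS'⟩ := Relation.church_rosser
    (fun a b c (hb : Par a b) (hc : Par a c) =>
      ⟨a.develop, Relation.ReflGen.single hb.develop, Relation.ReflTransGen.single hc.develop⟩)
    (key h) (key h')
  exact ⟨S, back hS, back hS'⟩

theorem FixBetaEq.refl (M : Tm C) : FixBetaEq M M := Relation.EqvGen.refl M

theorem FixBetaEq.symm {M N : Tm C} (h : FixBetaEq M N) : FixBetaEq N M :=
  Relation.EqvGen.symm _ _ h

theorem FixBetaEq.trans {M N R : Tm C} (h : FixBetaEq M N) (h' : FixBetaEq N R) : FixBetaEq M R :=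
  Relation.EqvGen.trans _ _ _ h h'

theorem Reduces.fixBetaEq {M N : Tm C} (h : Reduces M N) : FixBetaEq M N := by
  induction h with
  | refl => exact .refl _
  | tail _ h ih => exact ih.trans (Relation.EqvGen.rel _ _ h)

theorem FixBetaEq.common_reduct {M N : Tm C} (h : FixBetaEq M N) :
    ∃ R, Reduces M R ∧ Reduces N R := by
  induction h with
  | rel M N h => exact ⟨N, Step.reduces h, .refl N⟩
  | refl M => exact ⟨M, .refl M, .refl M⟩
  | symm _ _ _ ih => exact ih.imp fun _ h => h.symm
  | trans _ _ _ _ _ ih ih' =>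
    obtain ⟨R, h₁, h₂⟩ := ih
    obtain ⟨R', h₃, h₄⟩ := ih'
    obtain ⟨S, h₅, h₆⟩ := h₂.confluent h₃
    exact ⟨S, h₁.trans h₅, h₄.trans h₆⟩

theorem Reduces.of_var {n : ℕ} {M : Tm C} (h : Reduces (.var n) M) : M = .var n := by
  induction h with
  | refl => rfl
  | tail _ h ih => subst ih; rcases h with h | h <;> cases h

theorem Step.of_app {F M N : Tm C} (hF : ∀ R : Tm C, F ≠ .lam R) (h : Step (.app F M) N) :
    (∃ F', Step F F' ∧ N = .app F' M) ∨ ∃ M', Step M M' ∧ N = .app F M' := by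
  rcases h with h | h
  · cases h with
    | red R => exact absurd rfl (hF R)
    | appL _ h => exact .inl ⟨_, .inl h, rfl⟩
    | appR _ h => exact .inr ⟨_, .inl h, rfl⟩
  · cases h with
    | appL _ h => exact .inl ⟨_, .inr h, rfl⟩
    | appR _ h => exact .inr ⟨_, .inr h, rfl⟩

theorem Reduces.of_apps_con {c : C} {Ms : List (Tm C)} {N : Tm C}
    (h : Reduces ((Tm.con c).apps Ms) N) :
    ∃ Ns, N = (Tm.con c).apps Ns ∧ List.Forall₂ Reduces Ms Ns := by
  have one : ∀ {Ms : List (Tm C)} {N : Tm C}, Step ((Tm.con c).apps Ms) N →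
      ∃ Ns, N = (Tm.con c).apps Ns ∧ List.Forall₂ Reduces Ms Ns := by
    intro Ms
    induction Ms using List.reverseRecOn with
    | nil => intro N h; rcases h with h | h <;> cases h
    | append_singleton Ms M ih =>
      intro N h
      rw [Tm.apps_append_singleton] at h
      have hr : ∀ {Ms : List (Tm C)}, List.Forall₂ Reduces Ms Ms := fun {Ms} =>
        List.forall₂_same.mpr fun M _ => .refl M
      have hlam : ∀ R : Tm C, (Tm.con c).apps Ms ≠ .lam R := fun R hR => by
        have := Tm.head_apps (Tm.con c) Ms
        rw [hR] at this; cases this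
      rcases h.of_app hlam with ⟨N', h', rfl⟩ | ⟨M', h', rfl⟩
      · obtain ⟨Ns, rfl, hNs⟩ := ih h'
        exact ⟨Ns ++ [M], (Tm.apps_append_singleton _ _ _).symm, List.rel_append hNs hr⟩
      · exact ⟨Ms ++ [M'], (Tm.apps_append_singleton _ _ _).symm,
          List.rel_append hr (.cons h'.reduces .nil)⟩
  induction h with
  | refl => exact ⟨Ms, rfl, List.forall₂_same.mpr fun M _ => .refl M⟩
  | tail _ h ih =>
    obtain ⟨Ns, rfl, hNs⟩ := ih
    obtain ⟨Rs, rfl, hRs⟩ := one h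
    exact ⟨Rs, rfl, forall₂_trans (fun _ _ _ h h' => h.trans h') hNs hRs⟩

theorem FixBetaEq.reduces_var {M : Tm C} {n : ℕ} (h : FixBetaEq M (.var n)) :
    Reduces M (.var n) := by
  obtain ⟨R, h₁, h₂⟩ := h.common_reduct
  rwa [← h₂.of_var]

theorem FixBetaEq.reduces_apps_con {M : Tm C} {c : C} {Ns : List (Tm C)}
    (h : FixBetaEq M ((Tm.con c).apps Ns)) :
    ∃ Ms, Reduces M ((Tm.con c).apps Ms) ∧ List.Forall₂ FixBetaEq Ms Ns := by
  obtain ⟨R, h₁, h₂⟩ := h.common_reduct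
  obtain ⟨Ms, rfl, hMs⟩ := h₂.of_apps_con
  exact ⟨Ms, h₁, List.Forall₂.flip (hMs.imp fun _ _ h => h.fixBetaEq.symm)⟩

theorem FixBetaEq.apps_con_inj {c d : C} {Ms Ns : List (Tm C)}
    (h : FixBetaEq ((Tm.con c).apps Ms) ((Tm.con d).apps Ns)) :
    c = d ∧ List.Forall₂ FixBetaEq Ms Ns := by
  obtain ⟨R, h₁, h₂⟩ := h.common_reduct
  obtain ⟨Rs, rfl, hMs⟩ := h₁.of_apps_con
  obtain ⟨Rs', hR, hNs⟩ := h₂.of_apps_con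
  obtain ⟨rfl, rfl⟩ := Tm.apps_con_injective hR
  refine ⟨rfl, ?_⟩
  have hMs' : List.Forall₂ FixBetaEq Ms Rs := hMs.imp fun _ _ h => h.fixBetaEq
  have hNs' : List.Forall₂ FixBetaEq Rs Ns :=
    List.Forall₂.flip (hNs.imp fun _ _ h => h.fixBetaEq.symm)
  exact forall₂_trans (fun _ _ _ h h' => h.trans h') hMs' hNs'

theorem not_fixBetaEq_var_apps_con {n : ℕ} {c : C} {Ms : List (Tm C)} :
    ¬ FixBetaEq (.var n) ((Tm.con c).apps Ms) := by
  intro h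
  obtain ⟨Ns, h, -⟩ := h.reduces_apps_con
  have := congrArg Tm.head h.of_var
  rw [Tm.head_apps] at this
  cases this

theorem FixBetaEq.var_inj {m n : ℕ} (h : FixBetaEq (.var m : Tm C) (.var n)) : m = n :=
  Tm.var.inj h.reduces_var.of_var.symm

/-! ### The tree of a term -/

theorem exists_getElem?_of_forall₂ {α β : Type*} {R : α → β → Prop} {l : List α} {l' : List β}
    (h : List.Forall₂ R l l') {i : ℕ} {b : β} (hb : l'[i]? = some b) :
    ∃ a, l[i]? = some a ∧ R a b := by
  induction h generalizing i with
  | nil => simp at hb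
  | @cons a b' _ _ hab _ ih =>
    cases i with
    | zero =>
      simp only [List.getElem?_cons_zero, Option.some.injEq] at hb
      subst hb
      exact ⟨a, by simp, hab⟩
    | succ i => simpa using ih (by simpa using hb)

theorem Shows.of_fixBetaEq {M : Tm C} {w : List ℕ} {l : Label C} (h : Shows M w l) :
    ∀ {M' : Tm C}, FixBetaEq M' M → Shows M' w l := by
  induction h with
  | con c Ms h =>
    intro M' h'
    obtain ⟨Ms', h₁, -⟩ := (h'.trans h.fixBetaEq).reduces_apps_con
    exact .con c Ms' h₁
  | var x h => exact fun h' => .var x (h'.trans h.fixBetaEq).reduces_var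
  | child c Ms i N w l h hN _ ih =>
    intro M' h'
    obtain ⟨Ms', h₁, h₂⟩ := (h'.trans h.fixBetaEq).reduces_apps_con
    obtain ⟨N', hN', hNN⟩ := exists_getElem?_of_forall₂ h₂ hN
    exact .child c Ms' i N' w l h₁ hN' (ih hNN)

theorem shows_apps_con_nil {c : C} {Ms : List (Tm C)} {l : Label C} :
    Shows ((Tm.con c).apps Ms) [] l ↔ l = .con c := by
  constructor
  · intro h
    cases h with
    | con d Ns h => rw [(h.fixBetaEq.apps_con_inj).1]
    | var x h => exact absurd h.fixBetaEq.symm not_fixBetaEq_var_apps_con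
  · rintro rfl
    exact .con c Ms (.refl _)

theorem shows_apps_con_cons {c : C} {Ms : List (Tm C)} {i : ℕ} {w : List ℕ} {l : Label C} :
    Shows ((Tm.con c).apps Ms) (i :: w) l ↔ ∃ N, Ms[i]? = some N ∧ Shows N w l := by
  constructor
  · intro h
    cases h with
    | child d Ns _ N _ _ h hN hl =>
      obtain ⟨M, hM, hMN⟩ := exists_getElem?_of_forall₂ (h.fixBetaEq.apps_con_inj).2 hN
      exact ⟨M, hM, hl.of_fixBetaEq hMN⟩
  · rintro ⟨N, hN, hl⟩
    exact .child c Ms i N w l (.refl _) hN hl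

theorem Shows.unique {M : Tm C} {w : List ℕ} {l l' : Label C} (h : Shows M w l)
    (h' : Shows M w l') : l = l' := by
  induction h with
  | con c Ms h => exact (shows_apps_con_nil.1 (h'.of_fixBetaEq h.fixBetaEq.symm)).symm
  | var x h =>
    cases h'.of_fixBetaEq h.fixBetaEq.symm with
    | con d Ns h => exact absurd h.fixBetaEq not_fixBetaEq_var_apps_con
    | var y h => rw [h.fixBetaEq.var_inj]
  | child c Ms i N w l h hN _ ih =>
    obtain ⟨N', hN', hl⟩ := shows_apps_con_cons.1 (h'.of_fixBetaEq h.fixBetaEq.symm)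
    rw [hN] at hN'
    cases hN'
    exact ih hl

namespace Tm

theorem tree_eq_some_iff {M : Tm C} {w : List ℕ} {l : Label C} :
    M.tree w = some l ↔ Shows M w l := by
  unfold tree
  split_ifs with h
  · rw [Option.some.injEq]
    exact ⟨fun e => e ▸ h.choose_spec, fun hl => h.choose_spec.unique hl⟩
  · exact ⟨nofun, fun hl => absurd ⟨l, hl⟩ h⟩

theorem tree_congr {M N : Tm C} (h : FixBetaEq M N) : M.tree = N.tree := by
  funext w
  apply Option.ext
  intro l
  rw [tree_eq_some_iff, tree_eq_some_iff]
  exact ⟨fun hl => hl.of_fixBetaEq h.symm, fun hl => hl.of_fixBetaEq h⟩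

theorem tree_apps_con_nil (c : C) (Ms : List (Tm C)) :
    ((con c).apps Ms).tree [] = some (.con c) := by
  rw [tree_eq_some_iff, shows_apps_con_nil]

theorem tree_apps_con_cons (c : C) (Ms : List (Tm C)) (i : ℕ) (w : List ℕ) :
    ((con c).apps Ms).tree (i :: w) = Ms[i]?.bind fun N => N.tree w := by
  apply Option.ext
  intro l
  rw [tree_eq_some_iff, shows_apps_con_cons, Option.bind_eq_some_iff]
  simp only [tree_eq_some_iff]

theorem tree_var_nil (n : ℕ) : (var n : Tm C).tree [] = some (.var n) := by
  rw [tree_eq_some_iff]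
  exact .var n (.refl _)

end Tm

/-! ### Productive terms -/

/-- `M` reduces to a variable of index below `n`, or to a function symbol of `Σ` applied to the
right number of terms, all in `S`. -/
inductive Unfolds (Sg : Sig C) (n : ℕ) (S : Set (Tm C)) (M : Tm C) : Prop
  | var (i : ℕ) (hi : i < n) (h : Reduces M (.var i))
  | con (f : C) (Ms : List (Tm C)) (h : Reduces M ((Tm.con f).apps Ms))
      (hf : Sg f = some (iotaArrows Ms.length .iota)) (hMs : ∀ N ∈ Ms, N ∈ S)

/-- Productive terms: the greatest predicate whose members unfold to variables of index below `n`,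
or to function symbols applied to productive terms. The tree of such a term is total. -/
def Productive (Sg : Sig C) (n : ℕ) (M : Tm C) : Prop :=
  ∃ S : Set (Tm C), M ∈ S ∧ ∀ N ∈ S, Unfolds Sg n S N

/-- Productive atoms: they reduce to a predicate of `Σ` applied to productive terms. -/
def ProductiveAtom (Sg : Sig C) (n : ℕ) (A : Tm C) : Prop :=
  ∃ (h : C) (Ms : List (Tm C)), Reduces A ((Tm.con h).apps Ms) ∧
    Sg h = some (iotaArrows Ms.length .o) ∧ ∀ N ∈ Ms, Productive Sg n N

theorem Productive.unfolds {Sg : Sig C} {n : ℕ} {M : Tm C} (h : Productive Sg n M) :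
    Unfolds Sg n {N | Productive Sg n N} M := by
  obtain ⟨S, hM, hS⟩ := h
  rcases hS M hM with ⟨i, hi, h⟩ | ⟨f, Ms, h, hf, hMs⟩
  · exact .var i hi h
  · exact .con f Ms h hf fun N hN => ⟨S, hMs N hN, hS⟩

theorem exists_mem_of_forall₂ {α β : Type*} {R : α → β → Prop} {l : List α} {l' : List β}
    (h : List.Forall₂ R l l') {a : α} (ha : a ∈ l) : ∃ b ∈ l', R a b := by
  induction h with
  | nil => cases ha
  | cons hab _ ih =>
    rcases List.mem_cons.1 ha with rfl | ha
    · exact ⟨_, List.mem_cons_self, hab⟩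
    · obtain ⟨b, hb, h⟩ := ih ha
      exact ⟨b, List.mem_cons_of_mem _ hb, h⟩

theorem Productive.of_fixBetaEq {Sg : Sig C} {n : ℕ} {M M' : Tm C} (hM : Productive Sg n M)
    (h : FixBetaEq M' M) : Productive Sg n M' := by
  refine ⟨{M' | ∃ M, Productive Sg n M ∧ FixBetaEq M' M}, ⟨M, hM, h⟩, ?_⟩
  rintro N' ⟨N, hN, hNN⟩
  rcases hN.unfolds with ⟨i, hi, h⟩ | ⟨f, Ms, h, hf, hMs⟩
  · exact .var i hi (hNN.trans h.fixBetaEq).reduces_var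
  · obtain ⟨Ms', h₁, h₂⟩ := (hNN.trans h.fixBetaEq).reduces_apps_con
    refine .con f Ms' h₁ (by rw [h₂.length_eq]; exact hf) fun N hN => ?_
    obtain ⟨R, hR, hNR⟩ := exists_mem_of_forall₂ h₂ hN
    exact ⟨R, hMs R hR, hNR⟩

theorem ProductiveAtom.of_fixBetaEq {Sg : Sig C} {n : ℕ} {A A' : Tm C}
    (hA : ProductiveAtom Sg n A) (h : FixBetaEq A' A) : ProductiveAtom Sg n A' := by
  obtain ⟨p, Ms, h₁, hp, hMs⟩ := hA
  obtain ⟨Ms', h₂, h₃⟩ := (h.trans h₁.fixBetaEq).reduces_apps_con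
  refine ⟨p, Ms', h₂, by rw [h₃.length_eq]; exact hp, fun N hN => ?_⟩
  obtain ⟨R, hR, hNR⟩ := exists_mem_of_forall₂ h₃ hN
  exact (hMs R hR).of_fixBetaEq hNR

theorem Productive.of_apps_con {Sg : Sig C} {n : ℕ} {c : C} {Ms : List (Tm C)}
    (h : Productive Sg n ((Tm.con c).apps Ms)) :
    Sg c = some (iotaArrows Ms.length .iota) ∧ ∀ N ∈ Ms, Productive Sg n N := by
  rcases h.unfolds with ⟨i, hi, h⟩ | ⟨f, Ns, h, hf, hNs⟩
  · exact absurd h.fixBetaEq.symm not_fixBetaEq_var_apps_con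
  · obtain ⟨rfl, h'⟩ := h.fixBetaEq.apps_con_inj
    refine ⟨by rw [h'.length_eq]; exact hf, fun N hN => ?_⟩
    obtain ⟨R, hR, hNR⟩ := exists_mem_of_forall₂ h' hN
    exact Productive.of_fixBetaEq (hNs R hR) hNR

theorem ProductiveAtom.of_apps_con {Sg : Sig C} {n : ℕ} {c : C} {Ms : List (Tm C)}
    (h : ProductiveAtom Sg n ((Tm.con c).apps Ms)) : ∀ N ∈ Ms, Productive Sg n N := by
  obtain ⟨p, Ns, h, hp, hNs⟩ := h
  obtain ⟨rfl, h'⟩ := h.fixBetaEq.apps_con_inj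
  intro N hN
  obtain ⟨R, hR, hNR⟩ := exists_mem_of_forall₂ h' hN
  exact (hNs R hR).of_fixBetaEq hNR

/-! ### Guarded terms are productive -/

theorem arrows_append_singleton (ts : List Ty) (a s : Ty) :
    arrows (ts ++ [a]) s = arrows ts (.arr a s) := by
  induction ts with
  | nil => rfl
  | cons t ts ih => simp [arrows, ih]

theorem arity_iotaArrows (n : ℕ) {s : Ty} (hs : s.arity = 0) : (iotaArrows n s).arity = n := by
  unfold iotaArrows
  induction n with
  | zero => exact hs
  | succ n ih => simp [List.replicate_succ, arrows, Ty.arity, ih]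

theorem arrows_inj {s s' : Ty} (hs : s.arity = 0) (hs' : s'.arity = 0) {ts ts' : List Ty}
    (h : arrows ts s = arrows ts' s') : ts = ts' ∧ s = s' := by
  induction ts generalizing ts' with
  | nil =>
    cases ts' with
    | nil => exact ⟨rfl, h⟩
    | cons t ts' => simp only [arrows] at h; subst h; simp [Ty.arity] at hs
  | cons t ts ih =>
    cases ts' with
    | nil => simp only [arrows] at h; subst h; simp [Ty.arity] at hs'
    | cons t' ts' =>
      simp only [arrows, Ty.arr.injEq] at h
      obtain ⟨rfl, h⟩ := h
      obtain ⟨rfl, rfl⟩ := ih h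
      exact ⟨rfl, rfl⟩

theorem Sig.FirstOrder.eq_replicate {Sg : Sig C} (hSg : Sg.FirstOrder) {c : C} {ts : List Ty}
    {s : Ty} (hs : s.arity = 0) (h : Sg c = some (arrows ts s)) :
    ts = List.replicate ts.length .iota := by
  obtain ⟨n, h' | h'⟩ := hSg c _ h
  all_goals
    obtain ⟨rfl, -⟩ := arrows_inj hs rfl h'
    simp

theorem forall_mem_of_forall₂_replicate {α β : Type*} {R : α → β → Prop} {l : List α} {b : β}
    {n : ℕ} (h : List.Forall₂ R l (List.replicate n b)) : ∀ a ∈ l, R a b := by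
  intro a ha
  obtain ⟨b', hb, hR⟩ := exists_mem_of_forall₂ h ha
  rwa [List.eq_of_mem_replicate hb] at hR

/-- A first-order part is a variable, or a constant applied to first-order parts. -/
theorem FOPart.spine {Sg : Sig C} {n : ℕ} {M : Tm C} {t : Ty}
    (h : FOPart Sg (List.replicate n .iota) M t) :
    (∃ i < n, M = .var i ∧ t = .iota) ∨
      ∃ (f : C) (Ms : List (Tm C)) (ts : List Ty), M = (Tm.con f).apps Ms ∧
        Sg f = some (arrows ts t) ∧
        List.Forall₂ (FOPart Sg (List.replicate n .iota)) Ms ts := by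
  induction h with
  | var h _ _ =>
    rw [List.getElem?_replicate] at h
    split_ifs at h with hi
    exact .inl ⟨_, hi, rfl, (Option.some.inj h).symm⟩
  | @con c t h _ _ => exact .inr ⟨c, [], [], rfl, h, .nil⟩
  | @app M N a b _ hN _ ih _ =>
    rcases ih with ⟨i, _, _, h⟩ | ⟨f, Ms, ts, rfl, hf, hMs⟩
    · cases h
    · refine .inr ⟨f, Ms ++ [N], ts ++ [a], (Tm.apps_append_singleton _ _ _).symm, ?_, ?_⟩
      · rw [arrows_append_singleton]; exact hf
      · exact List.rel_append hMs (.cons hN .nil)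

theorem FirstOrderTm.unfolds {Sg : Sig C} (hSg : Sg.FirstOrder) {n : ℕ} {M : Tm C}
    (h : FirstOrderTm Sg (List.replicate n .iota) M .iota) :
    Unfolds Sg n {N | FirstOrderTm Sg (List.replicate n .iota) N .iota} M := by
  rcases h.1.spine with ⟨i, hi, rfl, -⟩ | ⟨f, Ms, ts, rfl, hf, hMs⟩
  · exact .var i hi (.refl _)
  · have hts := hSg.eq_replicate rfl hf
    rw [hts] at hMs hf
    refine .con f Ms (.refl _) ?_ fun N hN => ⟨forall_mem_of_forall₂_replicate hMs N hN, rfl⟩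
    rw [hf, hMs.length_eq, List.length_replicate]
    rfl

theorem FOPart.subst {Sg : Sig C} {Γ : List Ty} {m : ℕ} {M : Tm C} {t : Ty}
    (h : FOPart Sg (List.replicate m .iota) M t) {s : ℕ → Tm C}
    (hs : ∀ j < m, FirstOrderTm Sg Γ (s j) .iota) : FOPart Sg Γ (M.subst s) t := by
  induction h with
  | var h _ _ =>
    rw [List.getElem?_replicate] at h
    split_ifs at h with hi
    cases h
    exact (hs _ hi).1
  | con h h' h'' => exact .con h h' h''
  | app _ _ hb ih ih' => exact .app ih ih' hb

/-- `m` successive `β`-steps contract `(λ y₁ … yₘ. B) M₁ … Mₘ` by one simultaneous substitution. -/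
theorem exists_subst_reduces_lams_apps (Ms : List (Tm C)) :
    ∃ s : ℕ → Tm C, (∀ j < Ms.length, s j ∈ Ms) ∧ (∀ j, s (Ms.length + j) = .var j) ∧
      ∀ B : Tm C, Reduces ((Tm.lams Ms.length B).apps Ms) (B.subst s) := by
  induction Ms with
  | nil =>
    exact ⟨.var, nofun, fun j => by simp, fun B => by rw [Tm.subst_var]; exact .refl B⟩
  | cons M Ms ih =>
    obtain ⟨s, hs, hs', hB⟩ := ih
    have hlast : ∀ R : Tm C, (R.rename (Ms.length + ·)).subst s = R := fun R => by
      rw [Tm.subst_rename]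
      exact (congrArg (fun s => R.subst s) (funext hs')).trans (Tm.subst_var R)
    refine ⟨fun j => (Tm.liftSub^[Ms.length] (Tm.instSub M) j).subst s, fun j hj => ?_,
      fun j => ?_, fun B => ?_⟩
    · rcases Nat.lt_or_eq_of_le (Nat.lt_succ_iff.1 hj) with h | rfl
      · beta_reduce
        rw [Tm.iterate_liftSub_of_lt h]
        exact List.mem_cons_of_mem _ (hs j h)
      · have := Tm.iterate_liftSub_add Ms.length 0 (Tm.instSub M)
        rw [Nat.add_zero] at this
        beta_reduce
        rw [this, hlast]
        exact List.mem_cons_self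
    · have := Tm.iterate_liftSub_add Ms.length (j + 1) (Tm.instSub M)
      beta_reduce
      rw [List.length_cons, show Ms.length + 1 + j = Ms.length + (j + 1) by omega, this, hlast]
      rfl
    · have h : Reduces ((Tm.lams (Ms.length + 1) B).app M)
          (Tm.lams Ms.length (B.subst (Tm.liftSub^[Ms.length] (Tm.instSub M)))) := by
        rw [← Tm.subst_lams]
        unfold Tm.lams
        rw [Function.iterate_succ_apply']
        exact Step.reduces (.inl (.red _ _))
      have := (h.apps Ms).trans (hB _)
      rwa [Tm.subst_subst] at this

/-- A guarded fixed-point term applied to first-order terms exposes, after one unfolding of the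
fixed point, its guard `f` over arguments that are again guarded full terms. -/
theorem GuardedFull.unfolds {Sg : Sig C} (hSg : Sg.FirstOrder) {n : ℕ} {M : Tm C}
    (h : GuardedFull Sg (List.replicate n .iota) M .iota) :
    Unfolds Sg n {N | GuardedFull Sg (List.replicate n .iota) N .iota} M := by
  rcases h with h | ⟨-, F, Ms, ⟨f, Ls, Ls', Ns, hF, hf, hNs, hfo, hocc⟩, hMs, rfl⟩
  · rcases h.unfolds hSg with ⟨i, hi, h⟩ | ⟨f, Ms, h, hf, hMs⟩
    · exact .var i hi h
    · exact .con f Ms h hf fun N hN => .inl (hMs N hN)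
  · obtain ⟨s, hs, hs', hB⟩ := exists_subst_reduces_lams_apps Ms
    set m := Ms.length with hm
    set s₁ : ℕ → Tm C := fun j => (Tm.liftSub^[m] (Tm.instSub F) j).subst s with hs₁
    -- The recursive call is `F` itself: the shift past the `y`s is undone by the `β`-steps.
    have hvar : s₁ m = F := by
      have := Tm.iterate_liftSub_add m 0 (Tm.instSub F)
      rw [Nat.add_zero] at this
      simp only [hs₁, this, Tm.subst_rename]
      exact (congrArg (fun s => F.subst s) (funext hs')).trans (Tm.subst_var F)
    have hlt : ∀ j < m, FirstOrderTm Sg (List.replicate n .iota) (s₁ j) .iota := fun j hj => by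
      simp only [hs₁, Tm.iterate_liftSub_of_lt hj]
      exact hMs _ (hs j hj)
    have hsub : ∀ N ∈ Ls ++ Ls' ++ Ns,
        FirstOrderTm Sg (List.replicate n .iota) (N.subst s₁) .iota := fun N hN =>
      ⟨(hfo N hN).1.subst hlt, rfl⟩
    have hred : Reduces (F.apps Ms) ((Tm.con f).apps
        (Ls.map (Tm.subst s₁) ++ [F.apps (Ns.map (Tm.subst s₁))] ++ Ls'.map (Tm.subst s₁))) := by
      have h₁ : Reduces F (Tm.lams m (((Tm.con f).apps (Ls ++ [(Tm.var m).apps Ns] ++ Ls')).subst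
          (Tm.liftSub^[m] (Tm.instSub F)))) := by
        rw [← Tm.subst_lams]
        conv_lhs => rw [hF]
        have := FixStep.red (Tm.lams m ((Tm.con f).apps (Ls ++ [(Tm.var m).apps Ns] ++ Ls')))
        rw [← hF] at this ⊢
        exact Step.reduces (.inr this)
      have h₂ := (h₁.apps Ms).trans (hB _)
      rw [Tm.subst_subst, ← hs₁] at h₂
      simp only [Tm.subst_apps, List.map_append, List.map_cons, List.map_nil] at h₂
      rw [show (Tm.var m : Tm C).subst s₁ = F from hvar] at h₂
      exact h₂
    refine .con f _ hred ?_ ?_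
    · rw [hf]; simp [Nat.add_assoc, Nat.add_comm 1]
    · intro N hN
      simp only [List.mem_append, List.mem_map, List.mem_singleton] at hN
      rcases hN with (⟨L, hL, rfl⟩ | rfl) | ⟨L, hL, rfl⟩
      · exact .inl (hsub L (by simp [hL]))
      · refine .inr ⟨rfl, F, _, ?_, ?_, rfl⟩
        · rw [List.length_map, hNs]
          exact ⟨f, Ls, Ls', Ns, hF, hf, hNs, hfo, hocc⟩
        · intro N hN
          obtain ⟨L, hL, rfl⟩ := List.mem_map.1 hN
          exact hsub L (by simp [hL])
      · exact .inl (hsub L (by simp [hL]))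

theorem GuardedAtom.productiveAtom {Sg : Sig C} (hSg : Sg.FirstOrder) {n : ℕ} {A : Tm C}
    (h : GuardedAtom Sg (List.replicate n .iota) A) : ProductiveAtom Sg n A := by
  obtain ⟨-, p, ts, Ms, hp, hMs, hA⟩ := h
  refine ProductiveAtom.of_fixBetaEq ⟨p, Ms, .refl _, ?_, ?_⟩ hA
  · rw [hMs.length_eq, hp, hSg.eq_replicate rfl hp]
    simp [iotaArrows]
  · rw [hSg.eq_replicate rfl hp] at hMs
    intro N hN
    exact ⟨_, forall_mem_of_forall₂_replicate hMs N hN, fun R hR => GuardedFull.unfolds hSg hR⟩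

/-! ### Closed trees -/

/-- The conditions of `IsClosedTree` at the node `w`, when that node is not the root of a
tree-atom. -/
def ClosedAt (Sg : Sig C) (T : LTree C) (w : List ℕ) : Prop :=
  (∀ l, T w = some l → ∃ c k, l = .con c ∧ Sg c = some (iotaArrows k .iota)) ∧
    (∀ i, T (w ++ [i]) ≠ none → T w ≠ none) ∧
    ∀ c s, T w = some (.con c) → Sg c = some s → ∀ i, T (w ++ [i]) ≠ none ↔ i < s.arity

theorem IsClosedTree.closedAt {Sg : Sig C} {T : LTree C} (h : IsClosedTree Sg .iota T)
    (w : List ℕ) : ClosedAt Sg T w := by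
  refine ⟨fun l hl => ?_, h.prefixClosed w, h.branching w⟩
  rcases eq_or_ne w [] with rfl | hw
  · obtain ⟨c, k, hc, hk⟩ := h.root
    rw [hc] at hl
    cases hl
    exact ⟨c, k, rfl, hk⟩
  · exact h.inner w l hw hl

/-- A node labelled by a constant of target type `τ` over the right number of closed tree-terms. -/
theorem IsClosedTree.of_closedAt {Sg : Sig C} {T : LTree C} {t : Ty} (ht : t.arity = 0) {c : C}
    {k : ℕ} (hT : T [] = some (.con c)) (hc : Sg c = some (iotaArrows k t))
    (hlt : ∀ i < k, T [i] ≠ none ∧ ∀ w, ClosedAt Sg (fun v => T (i :: v)) w)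
    (hge : ∀ i, k ≤ i → ∀ w, T (i :: w) = none) : IsClosedTree Sg t T where
  root := ⟨c, k, hT, hc⟩
  inner w l hw hl := by
    cases w with
    | nil => exact absurd rfl hw
    | cons i w =>
      rcases Nat.lt_or_ge i k with hi | hi
      · exact ((hlt i hi).2 w).1 l hl
      · rw [hge i hi] at hl; cases hl
  prefixClosed w j := by
    cases w with
    | nil => intro _; rw [hT]; nofun
    | cons i w =>
      intro hj
      rcases Nat.lt_or_ge i k with hi | hi
      · exact ((hlt i hi).2 w).2.1 j hj
      · exact absurd (hge i hi _) hj
  branching w d s hd hs j := by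
    cases w with
    | nil =>
      rw [hT] at hd
      cases hd
      rw [hc] at hs
      cases hs
      rw [arity_iotaArrows k ht, List.nil_append]
      refine ⟨fun hj => ?_, fun hj => (hlt j hj).1⟩
      by_contra hk
      exact hj (hge j (Nat.le_of_not_lt hk) [])
    | cons i w =>
      rcases Nat.lt_or_ge i k with hi | hi
      · exact ((hlt i hi).2 w).2.2 d s hd hs j
      · rw [hge i hi] at hd; cases hd

/-- Coinduction principle for the coinductive Herbrand universe. -/
theorem mem_herbrandUniverse_of_coinduction {Sg : Sig C} (X : Set (LTree C))
    (hX : ∀ T ∈ X, T ∈ herbrandUniverse Sg ∨ ∃ c k, T [] = some (.con c) ∧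
      Sg c = some (iotaArrows k .iota) ∧ (∀ i < k, (fun v => T (i :: v)) ∈ X) ∧
      ∀ i, k ≤ i → ∀ w, T (i :: w) = none) {T : LTree C} (hT : T ∈ X) :
    T ∈ herbrandUniverse Sg := by
  have root : ∀ T ∈ X, T [] ≠ none := fun T hT => by
    rcases hX T hT with h | ⟨c, k, hc, -⟩
    · obtain ⟨c, k, hc, -⟩ := h.root
      rw [hc]; nofun
    · rw [hc]; nofun
  have key : ∀ w, ∀ T ∈ X, ClosedAt Sg T w := by
    intro w
    induction w with
    | nil =>
      intro T hT
      rcases hX T hT with h | ⟨c, k, hc, hk, hlt, hge⟩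
      · exact h.closedAt []
      · refine ⟨fun l hl => ?_, fun i _ => root T hT, fun d s hd hs i => ?_⟩
        · rw [hc] at hl
          cases hl
          exact ⟨c, k, rfl, hk⟩
        · rw [hc] at hd
          cases hd
          rw [hk] at hs
          cases hs
          rw [arity_iotaArrows k rfl, List.nil_append]
          refine ⟨fun hj => ?_, fun hj => root _ (hlt i hj)⟩
          by_contra hk
          exact hj (hge i (Nat.le_of_not_lt hk) [])
    | cons i w ih =>
      intro T hT
      rcases hX T hT with h | ⟨c, k, hc, hk, hlt, hge⟩
      · exact h.closedAt _
      · rcases Nat.lt_or_ge i k with hi | hi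
        · exact ih _ (hlt i hi)
        · refine ⟨fun l hl => ?_, fun j hj => absurd (hge i hi _) hj, fun d s hd => ?_⟩
          · rw [hge i hi] at hl; cases hl
          · rw [hge i hi] at hd; cases hd
  rcases hX T hT with h | ⟨c, k, hc, hk, hlt, hge⟩
  · exact h
  · exact .of_closedAt rfl hc hk (fun i hi => ⟨root _ (hlt i hi), fun w => key w _ (hlt i hi)⟩) hge

/-! ### Substitution in trees and evaluation of eigenconstants -/

namespace LTree

theorem subst_go_none (σ : ℕ → LTree C) (w : List ℕ) : subst.go σ w (fun _ => none) = none := by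
  induction w with
  | nil => rfl
  | cons i w ih => exact ih

theorem subst_of_var {T : LTree C} {x : ℕ} (h : T [] = some (.var x)) (σ : ℕ → LTree C) :
    T.subst σ = σ x := by
  funext w
  unfold subst subst.go
  rw [h]

theorem subst_nil_of_con {T : LTree C} {c : C} (h : T [] = some (.con c)) (σ : ℕ → LTree C) :
    T.subst σ [] = some (.con c) := by
  unfold subst subst.go
  rw [h]

theorem subst_cons_of_con {T : LTree C} {c : C} (h : T [] = some (.con c)) (σ : ℕ → LTree C)
    (i : ℕ) (w : List ℕ) : T.subst σ (i :: w) = LTree.subst (fun v => T (i :: v)) σ w := by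
  conv_lhs => unfold subst subst.go
  rw [h]
  rfl

/-- The tree which `ρ` grafts at the root of `T`. -/
def grafted (ρ : C → Option (LTree C)) (T : LTree C) : Option (LTree C) :=
  match T [] with
  | some (.con c) => ρ c
  | _ => none

/-- The label at the node `w` of the tree which results from `T` by replacing every sub-tree whose
root is a constant `c` in the domain of `ρ` with the tree `ρ c`. -/
def evalAt (ρ : C → Option (LTree C)) : List ℕ → LTree C → Option (Label C)
  | [], T => (T.grafted ρ).elim (T []) (· [])
  | i :: w, T => (T.grafted ρ).elim (evalAt ρ w fun v => T (i :: v)) (· (i :: w))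

theorem evalAt_none (ρ : C → Option (LTree C)) (w : List ℕ) :
    evalAt ρ w (fun _ => none) = none := by
  induction w with
  | nil => rfl
  | cons i w ih => exact ih

end LTree

/-- The value of a closed term: its tree, in which the constants in the domain of `ρ` are replaced
with trees. -/
noncomputable def Tm.val (ρ : C → Option (LTree C)) (M : Tm C) : LTree C :=
  fun w => LTree.evalAt ρ w M.tree

namespace Tm

variable {ρ : C → Option (LTree C)}

theorem val_congr {M N : Tm C} (h : FixBetaEq M N) : M.val ρ = N.val ρ := by
  unfold val
  rw [tree_congr h]

theorem grafted_tree_apps_con (c : C) (Ms : List (Tm C)) :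
    (((con c).apps Ms).tree).grafted ρ = ρ c := by
  unfold LTree.grafted
  rw [tree_apps_con_nil]

theorem val_apps_con_of_some {c : C} {T : LTree C} (h : ρ c = some T) (Ms : List (Tm C)) :
    ((con c).apps Ms).val ρ = T := by
  funext w
  unfold val
  cases w <;> simp [LTree.evalAt, grafted_tree_apps_con, h]

theorem val_apps_con_nil {c : C} (h : ρ c = none) (Ms : List (Tm C)) :
    ((con c).apps Ms).val ρ [] = some (.con c) := by
  simp [val, LTree.evalAt, grafted_tree_apps_con, h, tree_apps_con_nil]

theorem val_apps_con_cons {c : C} (h : ρ c = none) (Ms : List (Tm C)) (i : ℕ) (w : List ℕ) :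
    ((con c).apps Ms).val ρ (i :: w) = Ms[i]?.bind fun N => N.val ρ w := by
  simp only [val, LTree.evalAt, grafted_tree_apps_con, h, tree_apps_con_cons, Option.elim]
  cases Ms[i]? with
  | none => exact LTree.evalAt_none ρ w
  | some N => rfl

theorem tree_subst_apps_con_nil (c : C) (Ms : List (Tm C)) (τ : ℕ → LTree C) :
    ((con c).apps Ms).tree.subst τ [] = some (.con c) :=
  LTree.subst_nil_of_con (tree_apps_con_nil c Ms) τ

theorem tree_subst_apps_con_cons (c : C) (Ms : List (Tm C)) (τ : ℕ → LTree C) (i : ℕ)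
    (w : List ℕ) :
    ((con c).apps Ms).tree.subst τ (i :: w) = Ms[i]?.bind fun N => N.tree.subst τ w := by
  rw [LTree.subst_cons_of_con (tree_apps_con_nil c Ms)]
  simp only [tree_apps_con_cons]
  cases Ms[i]? with
  | none => exact LTree.subst_go_none τ w
  | some N => rfl

end Tm

theorem Sig.extend_self (Sg : Sig C) (c : C) (t : Ty) : Sg.extend c t c = some t := by
  classical
  exact Function.update_self (β := fun _ => Option Ty) c (some t) Sg

theorem Sig.extend_of_ne {Sg : Sig C} {c d : C} (h : d ≠ c) (t : Ty) :
    Sg.extend c t d = Sg d := by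
  classical
  exact Function.update_of_ne (β := fun _ => Option Ty) h (some t) Sg

/-- `Σ'` extends `Σ` by the constants in the domain of `ρ`, which have type `ι` and to which `ρ`
assigns closed tree-terms over `Σ`. -/
def EigenExtension (Sg Sg' : Sig C) (ρ : C → Option (LTree C)) : Prop :=
  ∀ c, (ρ c = none ∧ Sg' c = Sg c) ∨
    ∃ T, ρ c = some T ∧ T ∈ herbrandUniverse Sg ∧ Sg c = none ∧ Sg' c = some .iota

namespace EigenExtension

variable {Sg Sg' : Sig C} {ρ : C → Option (LTree C)}

theorem refl (Sg : Sig C) : EigenExtension Sg Sg fun _ => none := fun _ => .inl ⟨rfl, rfl⟩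

theorem eq_none_of_eq_some (h : EigenExtension Sg Sg' ρ) {c : C} {t : Ty} (hc : Sg c = some t) :
    ρ c = none := by
  rcases h c with h | ⟨T, -, -, hc', -⟩
  · exact h.1
  · rw [hc] at hc'; cases hc'

theorem firstOrder (h : EigenExtension Sg Sg' ρ) (hSg : Sg.FirstOrder) : Sg'.FirstOrder := by
  intro c t hc
  rcases h c with ⟨-, hc'⟩ | ⟨T, -, -, -, hc'⟩
  · exact hSg c t (hc' ▸ hc)
  · rw [hc] at hc'
    cases hc'
    exact ⟨0, .inl rfl⟩

open Classical in
theorem extend (h : EigenExtension Sg Sg' ρ) {c : C} (hc : Sg' c = none) {T : LTree C}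
    (hT : T ∈ herbrandUniverse Sg) :
    EigenExtension Sg (Sg'.extend c .iota) (Function.update ρ c (some T)) := by
  have hc' : Sg c = none := by
    rcases h c with ⟨-, h⟩ | ⟨_, -, -, -, h⟩
    · rw [← h, hc]
    · rw [hc] at h; cases h
  intro d
  rcases eq_or_ne d c with rfl | hd
  · exact .inr ⟨T, by simp, hT, hc', Sig.extend_self Sg' d .iota⟩
  · rw [Function.update_of_ne hd, Sig.extend_of_ne hd]
    exact h d

/-- The value of a productive closed term is a closed tree-term. -/
theorem val_mem_herbrandUniverse (h : EigenExtension Sg Sg' ρ) {M : Tm C}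
    (hM : Productive Sg' 0 M) : M.val ρ ∈ herbrandUniverse Sg := by
  refine mem_herbrandUniverse_of_coinduction {T | ∃ M, Productive Sg' 0 M ∧ M.val ρ = T} ?_
    ⟨M, hM, rfl⟩
  rintro _ ⟨M, hM, rfl⟩
  rcases hM.unfolds with ⟨i, hi, -⟩ | ⟨f, Ms, hf, hfs, hMs⟩
  · exact absurd hi (Nat.not_lt_zero i)
  · rw [Tm.val_congr hf.fixBetaEq]
    rcases h f with ⟨hf', hf''⟩ | ⟨T, hT, hTU, -, -⟩
    · refine .inr ⟨f, Ms.length, Tm.val_apps_con_nil hf' Ms, hf'' ▸ hfs, fun i hi => ?_,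
        fun i hi w => ?_⟩
      · refine ⟨Ms[i], hMs _ (List.getElem_mem hi), ?_⟩
        funext w
        rw [Tm.val_apps_con_cons hf', List.getElem?_eq_getElem hi]
        rfl
      · rw [Tm.val_apps_con_cons hf', List.getElem?_eq_none hi]
        rfl
    · rw [Tm.val_apps_con_of_some hT]
      exact .inl hTU

/-- The value of a productive closed atom is a closed tree-atom. -/
theorem val_mem_herbrandBase (h : EigenExtension Sg Sg' ρ) {A : Tm C}
    (hA : ProductiveAtom Sg' 0 A) : A.val ρ ∈ herbrandBase Sg := by
  obtain ⟨p, Ms, hp, hps, hMs⟩ := hA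
  rw [Tm.val_congr hp.fixBetaEq]
  rcases h p with ⟨hp', hp''⟩ | ⟨T, -, -, -, hp'⟩
  · refine .of_closedAt rfl (Tm.val_apps_con_nil hp' Ms) (hp'' ▸ hps) (fun i hi => ?_)
      fun i hi w => ?_
    · have hmem := h.val_mem_herbrandUniverse (hMs _ (List.getElem_mem hi))
      have heq : (fun v => ((Tm.con p).apps Ms).val ρ (i :: v)) = Ms[i].val ρ := by
        funext w
        rw [Tm.val_apps_con_cons hp', List.getElem?_eq_getElem hi]
        rfl
      refine ⟨?_, fun w => ?_⟩
      · obtain ⟨c, k, hc, -⟩ := hmem.root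
        rw [show ((Tm.con p).apps Ms).val ρ [i] = Ms[i].val ρ [] from congrFun heq [], hc]
        nofun
      · rw [heq]
        exact hmem.closedAt w
    · rw [Tm.val_apps_con_cons hp', List.getElem?_eq_none hi]
      rfl
  · rw [hp'] at hps
    have := (arrows_inj (ts := []) rfl rfl (Option.some.inj hps)).2
    cases this

/-- Substitution commutes with taking trees. Only the variables that are replaced with productive
terms need to be considered: the others do not occur in the tree of `M`. -/
theorem tree_subst_eq_val (h : EigenExtension Sg Sg' ρ) {n : ℕ} {s : ℕ → Tm C} {τ : ℕ → LTree C}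
    (hτ : ∀ j < n, Productive Sg' 0 (s j) → τ j = (s j).val ρ) {M : Tm C}
    (hM : Productive Sg n M) (hMs : Productive Sg' 0 (M.subst s)) :
    M.tree.subst τ = (M.subst s).val ρ := by
  funext w
  induction w generalizing M with
  | nil =>
    rcases hM.unfolds with ⟨i, hi, hred⟩ | ⟨f, Ms, hred, hf, -⟩
    · have hs := (hred.subst s).fixBetaEq
      rw [Tm.tree_congr hred.fixBetaEq, Tm.val_congr hs, LTree.subst_of_var (Tm.tree_var_nil i),
        hτ i hi (hMs.of_fixBetaEq hs.symm)]
      rfl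
    · rw [Tm.tree_congr hred.fixBetaEq, Tm.val_congr (hred.subst s).fixBetaEq, Tm.subst_apps,
        Tm.tree_subst_apps_con_nil]
      exact (Tm.val_apps_con_nil (h.eq_none_of_eq_some hf) _).symm
  | cons k w ih =>
    rcases hM.unfolds with ⟨i, hi, hred⟩ | ⟨f, Ms, hred, hf, hNs⟩
    · have hs := (hred.subst s).fixBetaEq
      rw [Tm.tree_congr hred.fixBetaEq, Tm.val_congr hs, LTree.subst_of_var (Tm.tree_var_nil i),
        hτ i hi (hMs.of_fixBetaEq hs.symm)]
      rfl
    · have hs := (hred.subst s).fixBetaEq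
      have hMs' := hMs.of_fixBetaEq hs.symm
      rw [Tm.subst_apps] at hMs' hs
      rw [Tm.tree_congr hred.fixBetaEq, Tm.val_congr hs, Tm.tree_subst_apps_con_cons]
      refine Eq.trans ?_ (Tm.val_apps_con_cons (h.eq_none_of_eq_some hf) _ k w).symm
      rw [List.getElem?_map]
      cases hN : Ms[k]? with
      | none => rfl
      | some N =>
        have hmem := List.mem_of_getElem? hN
        exact ih (hNs N hmem) (hMs'.of_apps_con.2 _ (List.mem_map_of_mem hmem))

theorem tree_subst_eq_val_of_atom (h : EigenExtension Sg Sg' ρ) {n : ℕ} {s : ℕ → Tm C}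
    {τ : ℕ → LTree C} (hτ : ∀ j < n, Productive Sg' 0 (s j) → τ j = (s j).val ρ) {A : Tm C}
    (hA : ProductiveAtom Sg n A) (hAs : ProductiveAtom Sg' 0 (A.subst s)) :
    A.tree.subst τ = (A.subst s).val ρ := by
  obtain ⟨p, Ms, hred, hp, hMs⟩ := hA
  have hs := (hred.subst s).fixBetaEq
  have hAs' := hAs.of_fixBetaEq hs.symm
  rw [Tm.subst_apps] at hAs' hs
  rw [Tm.tree_congr hred.fixBetaEq, Tm.val_congr hs]
  have hρ := h.eq_none_of_eq_some hp
  funext w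
  cases w with
  | nil =>
    rw [Tm.tree_subst_apps_con_nil]
    exact (Tm.val_apps_con_nil hρ _).symm
  | cons i w =>
    rw [Tm.tree_subst_apps_con_cons]
    refine Eq.trans ?_ (Tm.val_apps_con_cons hρ _ i w).symm
    rw [List.getElem?_map]
    cases hN : Ms[i]? with
    | none => rfl
    | some N =>
      have hmem := List.mem_of_getElem? hN
      exact congrFun (h.tree_subst_eq_val hτ (hMs N hmem)
        (hAs'.of_apps_con _ (List.mem_map_of_mem hmem))) w

end EigenExtension

/-! ### The shape of formulae -/

namespace Tm

theorem head_ne_log {A : Tm C} (hA : A.Rigid ∨ A.Flexible) {l : LogC} : A.head ≠ log l := by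
  intro h
  rcases hA with ⟨c, hc⟩ | ⟨x, hx⟩
  · rw [h] at hc; cases hc
  · rw [h] at hx; cases hx

end Tm

theorem Reduces.of_app_app_log {l : LogC} {F G D : Tm C}
    (h : Reduces (.app (.app (.log l) F) G) D) :
    ∃ F' G', D = .app (.app (.log l) F') G' ∧ Reduces F F' ∧ Reduces G G' := by
  induction h with
  | refl => exact ⟨F, G, rfl, .refl F, .refl G⟩
  | tail _ h ih =>
    obtain ⟨F', G', rfl, hF, hG⟩ := ih
    rcases Step.of_app (by nofun) h with ⟨R, hR, rfl⟩ | ⟨R, hR, rfl⟩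
    · rcases hR.of_app (by nofun) with ⟨S, hS, rfl⟩ | ⟨S, hS, rfl⟩
      · rcases hS with hS | hS <;> cases hS
      · exact ⟨S, G', rfl, hF.trans hS.reduces, hG⟩
    · exact ⟨F', R, rfl, hF, hG.trans hR.reduces⟩

theorem Reduces.of_mkAll {t : Ty} {F D : Tm C} (h : Reduces (.mkAll t F) D) :
    ∃ F', D = .mkAll t F' ∧ Reduces F F' := by
  induction h with
  | refl => exact ⟨F, rfl, .refl F⟩
  | tail _ h ih =>
    obtain ⟨F', rfl, hF⟩ := ih
    rcases Step.of_app (by nofun) h with ⟨R, hR, rfl⟩ | ⟨R, hR, rfl⟩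
    · rcases hR with hR | hR <;> cases hR
    · rcases hR with hR | hR
      · cases hR with
        | lam hR => exact ⟨_, rfl, hF.trans (Step.reduces (.inl hR))⟩
      · cases hR with
        | lam hR => exact ⟨_, rfl, hF.trans (Step.reduces (.inr hR))⟩

theorem Reduces.of_mkAlls {t : Ty} {n : ℕ} {F D : Tm C} (h : Reduces ((Tm.mkAll t)^[n] F) D) :
    ∃ F', D = (Tm.mkAll t)^[n] F' ∧ Reduces F F' := by
  induction n generalizing D with
  | zero => exact ⟨D, rfl, h⟩
  | succ n ih =>
    rw [Function.iterate_succ_apply'] at h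
    obtain ⟨F', rfl, hF⟩ := h.of_mkAll
    obtain ⟨F'', rfl, hF'⟩ := ih hF
    exact ⟨F'', by rw [Function.iterate_succ_apply'], hF'⟩

theorem Reduces.rigid {A D : Tm C} (h : Reduces A D) (hA : A.Rigid) : D.Rigid := by
  obtain ⟨c, hc⟩ := hA
  obtain ⟨Ms, rfl⟩ := Tm.exists_apps_of_head_eq_con hc
  obtain ⟨Ns, rfl, -⟩ := h.of_apps_con
  exact ⟨c, by rw [Tm.head_apps]; rfl⟩

theorem AtomsGuarded.guardedAtom {Sg : Sig C} {Γ : List Ty} {A : Tm C}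
    (h : AtomsGuarded Sg Γ A) (hA : A.Rigid ∨ A.Flexible) : GuardedAtom Sg Γ A := by
  have hlog := fun l => Tm.head_ne_log hA (l := l)
  cases h with
  | atom h => exact h
  | _ => exact absurd rfl (hlog _)

theorem AtomsGuarded.of_mkAnd {Sg : Sig C} {Γ : List Ty} {F G : Tm C}
    (h : AtomsGuarded Sg Γ (F.mkAnd G)) : AtomsGuarded Sg Γ F ∧ AtomsGuarded Sg Γ G := by
  generalize hD : F.mkAnd G = D at h
  cases h with
  | atom h => subst hD; exact absurd rfl (Tm.head_ne_log h.1.2)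
  | and hF hG => cases hD; exact ⟨hF, hG⟩
  | _ => cases hD

theorem AtomsGuarded.of_mkImp {Sg : Sig C} {Γ : List Ty} {F G : Tm C}
    (h : AtomsGuarded Sg Γ (F.mkImp G)) : AtomsGuarded Sg Γ F ∧ AtomsGuarded Sg Γ G := by
  generalize hD : F.mkImp G = D at h
  cases h with
  | atom h => subst hD; exact absurd rfl (Tm.head_ne_log h.1.2)
  | imp hF hG => cases hD; exact ⟨hF, hG⟩
  | _ => cases hD

theorem AtomsGuarded.of_mkAll {Sg : Sig C} {Γ : List Ty} {t : Ty} {F : Tm C}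
    (h : AtomsGuarded Sg Γ (.mkAll t F)) : AtomsGuarded Sg (t :: Γ) F := by
  generalize hD : Tm.mkAll t F = D at h
  cases h with
  | atom h => subst hD; exact absurd rfl (Tm.head_ne_log h.1.2)
  | all hF => cases hD; exact hF
  | _ => cases hD

theorem AtomsGuarded.of_mkAlls {Sg : Sig C} {Γ : List Ty} {t : Ty} {n : ℕ} {F : Tm C}
    (h : AtomsGuarded Sg Γ ((Tm.mkAll t)^[n] F)) :
    AtomsGuarded Sg (List.replicate n t ++ Γ) F := by
  induction n generalizing Γ with
  | zero => exact h
  | succ n ih =>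
    rw [Function.iterate_succ_apply'] at h
    have := ih h.of_mkAll
    rwa [List.replicate_succ', List.append_assoc]

/-- The formula is a conjunction of rigid atoms with the property `p`. -/
inductive ConjAll (p : Tm C → Prop) : Tm C → Prop
  | atom {A : Tm C} : A.Rigid → p A → ConjAll p A
  | and {F G : Tm C} : ConjAll p F → ConjAll p G → ConjAll p (F.mkAnd G)

namespace ConjAll

variable {p : Tm C → Prop}

theorem of_atomic {A : Tm C} (h : ConjAll p A) (hA : A.Rigid ∨ A.Flexible) : p A := by
  have hlog := fun l => Tm.head_ne_log hA (l := l)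
  cases h with
  | atom _ h => exact h
  | and _ _ => exact absurd rfl (hlog _)

theorem of_mkAnd {F G : Tm C} (h : ConjAll p (F.mkAnd G)) : ConjAll p F ∧ ConjAll p G := by
  generalize hD : F.mkAnd G = D at h
  cases h with
  | atom h _ => subst hD; exact absurd rfl (Tm.head_ne_log (.inl h))
  | and hF hG => cases hD; exact ⟨hF, hG⟩

theorem head_of_head_eq_log {D : Tm C} (h : ConjAll p D) {l : LogC} (hD : D.head = .log l) :
    l = .and := by
  cases h with
  | atom h _ => exact absurd hD (Tm.head_ne_log (.inl h))
  | and _ _ => cases hD; rfl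

theorem productiveAtom {Sg : Sig C} (hSg : Sg.FirstOrder) {D : Tm C} (h : ConjAll p D)
    (hD : AtomsGuarded Sg [] D) : ConjAll (ProductiveAtom Sg 0) D := by
  induction h with
  | atom h _ => exact .atom h (GuardedAtom.productiveAtom hSg (n := 0) (hD.guardedAtom (.inl h)))
  | and _ _ ihF ihG => exact .and (ihF hD.of_mkAnd.1) (ihG hD.of_mkAnd.2)

/-- If `p` is stable under reduction backwards, then it passes from the conjuncts of a reduct to the
conjuncts of the original conjunction. -/
theorem forall_mem (hp : ∀ A A', Reduces A A' → p A' → p A) {s : ℕ → Tm C} {B : Tm C}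
    {Bs : List (Tm C)} (hB : ∀ A ∈ B :: Bs, A.Rigid) {D : Tm C}
    (hD : Reduces ((HForm.conj B Bs).subst s) D) (h : ConjAll p D) :
    ∀ A ∈ B :: Bs, p (A.subst s) := by
  induction Bs generalizing B D with
  | nil =>
    intro A hA
    obtain rfl := List.mem_singleton.1 hA
    exact hp _ _ hD (h.of_atomic (.inl (hD.rigid ((hB A hA).subst s))))
  | cons B' Bs ih =>
    obtain ⟨F, G, rfl, hF, hG⟩ := Reduces.of_app_app_log hD
    obtain ⟨h₁, h₂⟩ := of_mkAnd h
    intro A hA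
    rcases List.mem_cons.1 hA with rfl | hA'
    · exact hp _ _ hF (h₁.of_atomic (.inl (hF.rigid ((hB A hA).subst s))))
    · exact ih (fun A hA => hB A (List.mem_cons_of_mem _ hA)) hG h₂ A hA'

/-- The converse of `ConjAll.forall_mem`. -/
theorem of_forall_mem (hp : ∀ A A', Reduces A A' → p A → p A') {s : ℕ → Tm C} {B : Tm C}
    {Bs : List (Tm C)} (hB : ∀ A ∈ B :: Bs, A.Rigid) {D : Tm C}
    (hD : Reduces ((HForm.conj B Bs).subst s) D) (h : ∀ A ∈ B :: Bs, p (A.subst s)) :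
    ConjAll p D := by
  induction Bs generalizing B D with
  | nil =>
    exact .atom (hD.rigid ((hB B (by simp)).subst s)) (hp _ _ hD (h B (by simp)))
  | cons B' Bs ih =>
    obtain ⟨F, G, rfl, hF, hG⟩ := Reduces.of_app_app_log hD
    exact .and (.atom (hF.rigid ((hB B (by simp)).subst s)) (hp _ _ hF (h B (by simp))))
      (ih (fun A hA => hB A (List.mem_cons_of_mem _ hA)) hG
        fun A hA => h A (List.mem_cons_of_mem _ hA))

end ConjAll

/-! ### Instances of `H`-formulae -/

/-- A variable at the head of a term of type `τ` has a type with target `τ`. So it is not of type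
`ι` if `τ` is `o`, and all atoms of an `H`-formula are rigid. -/
theorem HasType.of_head_eq_var {Sg : Sig C} {Γ : List Ty} {M : Tm C} {t : Ty}
    (h : HasType Sg Γ M t) {x : ℕ} (hx : M.head = .var x) : ∃ ts, Γ[x]? = some (arrows ts t) := by
  induction h with
  | var h => cases hx; exact ⟨[], h⟩
  | app _ _ ih _ =>
    obtain ⟨ts, hts⟩ := ih hx
    exact ⟨ts ++ [_], by rw [hts, arrows_append_singleton]⟩
  | _ => cases hx

theorem Atomic.rigid {Sg : Sig C} {n : ℕ} {A : Tm C}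
    (h : Atomic Sg (List.replicate n .iota) A) : A.Rigid := by
  rcases h.2 with hA | ⟨x, hx⟩
  · exact hA
  · obtain ⟨ts, hts⟩ := h.1.of_head_eq_var hx
    rw [List.getElem?_replicate] at hts
    split_ifs at hts
    have := (arrows_inj (ts := []) rfl rfl (Option.some.inj hts)).2
    cases this

namespace HForm

/-- All atoms of the `H`-formula are rigid and productive. -/
def AtomsProductive (Sg : Sig C) (K : HForm C) : Prop :=
  ∀ A ∈ K.head :: K.body, A.Rigid ∧ ProductiveAtom Sg K.vars A

theorem atomsGuarded_of_conj {Sg : Sig C} {Γ : List Ty} {B : Tm C} {Bs : List (Tm C)}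
    (h : AtomsGuarded Sg Γ (conj B Bs)) : ∀ A ∈ B :: Bs, AtomsGuarded Sg Γ A := by
  induction Bs generalizing B with
  | nil =>
    intro A hA
    obtain rfl := List.mem_singleton.1 hA
    exact h
  | cons B' Bs ih =>
    obtain ⟨h₁, h₂⟩ := AtomsGuarded.of_mkAnd h
    intro A hA
    rcases List.mem_cons.1 hA with rfl | hA
    · exact h₁
    · exact ih h₂ A hA

theorem IsHFormula.atomsProductive {Sg : Sig C} (hSg : Sg.FirstOrder) {K : HForm C}
    (hK : K.IsHFormula Sg) (h : AtomsGuarded Sg [] K.formula) : K.AtomsProductive Sg := by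
  have h' := AtomsGuarded.of_mkAlls h
  rw [List.append_nil] at h'
  have hrigid : ∀ A ∈ K.head :: K.body, A.Rigid := fun A hA => by
    rcases List.mem_cons.1 hA with rfl | hA
    · exact hK.1.2
    · exact (hK.2 A hA).1.rigid
  refine fun A hA => ⟨hrigid A hA, GuardedAtom.productiveAtom hSg
    (AtomsGuarded.guardedAtom ?_ (.inl (hrigid A hA)))⟩
  unfold matrix at h'
  cases hb : K.body with
  | nil =>
    rw [hb] at h' hA
    obtain rfl := List.mem_singleton.1 hA
    exact h'
  | cons B Bs =>
    rw [hb] at h' hA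
    obtain ⟨h₁, h₂⟩ := AtomsGuarded.of_mkImp h'
    rcases List.mem_cons.1 hA with rfl | hA
    · exact h₂
    · exact atomsGuarded_of_conj h₁ A hA

/-- `D` results from `K` by instantiating some of its outer quantifiers and by reduction. -/
def HasInstance (K : HForm C) (D : Tm C) : Prop :=
  ∃ (k : ℕ) (s : ℕ → Tm C) (E : Tm C), D = (Tm.mkAll .iota)^[k] E ∧
    Reduces (K.matrix.subst (Tm.liftSub^[k] s)) E

theorem hasInstance_formula (K : HForm C) : K.HasInstance K.formula :=
  ⟨K.vars, .var, K.matrix, rfl, by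
    rw [Tm.iterate_liftSub_var, Tm.subst_var]; exact .refl _⟩

/-- Without quantifiers left, an instance of `K` is a reduct of the instantiated head of `K`, or an
implication whose premise and conclusion are reducts of the instantiated body and head. -/
theorem HasInstance.cases_of_head_ne_all {Sg : Sig C} {K : HForm C} (hK : K.AtomsProductive Sg)
    {D : Tm C} (h : K.HasInstance D) :
    (∃ D', D = .mkAll .iota D') ∨
      ∃ s, (K.body = [] ∧ Reduces (K.head.subst s) D ∧ D.Rigid) ∨
        ∃ B Bs G A, K.body = B :: Bs ∧ D = .mkImp G A ∧ Reduces ((conj B Bs).subst s) G ∧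
          Reduces (K.head.subst s) A ∧ A.Rigid := by
  have hhead : ∀ s, (K.head.subst s).Rigid := fun s =>
    (hK K.head List.mem_cons_self).1.subst s
  obtain ⟨k, s, E, rfl, hE⟩ := h
  cases k with
  | succ k => exact .inl ⟨_, Function.iterate_succ_apply' _ _ _⟩
  | zero =>
    refine .inr ⟨s, ?_⟩
    unfold matrix at hE
    cases hb : K.body with
    | nil =>
      rw [hb] at hE
      exact .inl ⟨rfl, hE, hE.rigid (hhead s)⟩
    | cons B Bs =>
      rw [hb] at hE
      obtain ⟨G, A, hD, hG, hA⟩ := Reduces.of_app_app_log hE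
      exact .inr ⟨B, Bs, G, A, rfl, hD, hG, hA, hA.rigid (hhead s)⟩

theorem HasInstance.not_mkAnd {Sg : Sig C} {K : HForm C} (hK : K.AtomsProductive Sg)
    {F G : Tm C} : ¬ K.HasInstance (F.mkAnd G) := by
  intro h
  rcases h.cases_of_head_ne_all hK with ⟨D', hD⟩ | ⟨s, ⟨-, -, hD⟩ | ⟨_, _, _, _, -, hD, -⟩⟩
  · cases hD
  · exact absurd rfl (Tm.head_ne_log (.inl hD))
  · cases hD

/-- Instances of `K` are stable under the rule `∀L`. -/
theorem HasInstance.of_mkAll {Sg : Sig C} {K : HForm C} (hK : K.AtomsProductive Sg) {t : Ty}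
    {D N D' : Tm C} (h : K.HasInstance (.mkAll t D)) (hD' : Reduces (D.inst N) D') :
    K.HasInstance D' := by
  obtain ⟨k, s, E, hD, hE⟩ := id h
  cases k with
  | zero =>
    exfalso
    unfold matrix at hE
    cases hb : K.body with
    | nil =>
      rw [hb] at hE
      have := hE.rigid ((hK K.head List.mem_cons_self).1.subst _)
      rw [show E = Tm.mkAll t D from hD.symm] at this
      exact absurd rfl (Tm.head_ne_log (.inl this))
    | cons B Bs =>
      rw [hb] at hE
      obtain ⟨G, A, rfl, -⟩ := Reduces.of_app_app_log hE
      cases hD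
  | succ k =>
    rw [Function.iterate_succ_apply'] at hD
    cases hD
    rw [Tm.inst, Tm.subst_mkAlls] at hD'
    obtain ⟨E', rfl, hE'⟩ := hD'.of_mkAlls
    refine ⟨k, Tm.scons N s, E', rfl, ?_⟩
    rw [← Tm.subst_iterate_inst]
    exact (hE.subst _).trans hE'

end HForm

section Instances

variable {Sg Sg' : Sig C} {ρ : C → Option (LTree C)}

/-- The values of the atoms of an instance of `K` form a tree-form ground instance of `K`, if these
atoms are productive. A witness which is not productive is replaced with an arbitrary closed
tree-term. -/
theorem EigenExtension.treeInstance (h : EigenExtension Sg Sg' ρ)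
    (hne : (herbrandUniverse Sg).Nonempty) {K : HForm C} (hK : K.AtomsProductive Sg)
    {s : ℕ → Tm C} (hs : ∀ A ∈ K.head :: K.body, ProductiveAtom Sg' 0 (A.subst s)) :
    TreeInstance Sg K {T | ∃ A ∈ K.body, T = (A.subst s).val ρ} ((K.head.subst s).val ρ) := by
  classical
  obtain ⟨T₀, hT₀⟩ := hne
  set τ : ℕ → LTree C := fun j => if Productive Sg' 0 (s j) then (s j).val ρ else T₀ with hτ
  have heq : ∀ A ∈ K.head :: K.body, A.tree.subst τ = (A.subst s).val ρ := fun A hA =>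
    h.tree_subst_eq_val_of_atom (fun j _ hj => if_pos hj) (hK A hA).2 (hs A hA)
  refine ⟨τ, fun i _ => ?_, ?_, (heq _ List.mem_cons_self).symm⟩
  · by_cases hi : Productive Sg' 0 (s i)
    · simp only [hτ, if_pos hi]
      exact h.val_mem_herbrandUniverse hi
    · simp only [hτ, if_neg hi]
      exact hT₀
  · ext T
    constructor
    · rintro ⟨A, hA, rfl⟩
      exact ⟨A, hA, (heq A (List.mem_cons_of_mem _ hA)).symm⟩
    · rintro ⟨A, hA, rfl⟩
      exact ⟨A, hA, heq A (List.mem_cons_of_mem _ hA)⟩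

/-- An atom which is an instance of `K` is the head of a tree-form ground instance of `K` without
body. -/
theorem EigenExtension.treeInstance_of_atom (h : EigenExtension Sg Sg' ρ)
    (hSg : Sg.FirstOrder) (hne : (herbrandUniverse Sg).Nonempty) {K : HForm C}
    (hK : K.AtomsProductive Sg) {A : Tm C} (hA : K.HasInstance A) (hA' : A.Rigid ∨ A.Flexible)
    (hg : AtomsGuarded Sg' [] A) : TreeInstance Sg K ∅ (A.val ρ) ∧ A.val ρ ∈ herbrandBase Sg := by
  have hprod := GuardedAtom.productiveAtom (h.firstOrder hSg) (n := 0) (hg.guardedAtom hA')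
  have hlog := fun l => Tm.head_ne_log hA' (l := l)
  refine ⟨?_, h.val_mem_herbrandBase hprod⟩
  rcases hA.cases_of_head_ne_all hK with ⟨D', rfl⟩ | ⟨s, ⟨hb, hred, -⟩ | ⟨_, _, _, _, -, rfl, -⟩⟩
  · exact absurd rfl (hlog _)
  · have := h.treeInstance hne hK (s := s) fun B hB => by
      rw [hb] at hB
      obtain rfl := List.mem_singleton.1 hB
      exact hprod.of_fixBetaEq hred.fixBetaEq
    rw [Tm.val_congr hred.fixBetaEq, hb] at this
    simpa using this
  · exact absurd rfl (hlog _)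

/-- If an implication is an instance of `K` and the values of all conjuncts of its premise are in
`J`, then its conclusion is the head of a tree-form ground instance of `K` with body in `J`. -/
theorem EigenExtension.treeInstance_of_imp (h : EigenExtension Sg Sg' ρ)
    (hSg : Sg.FirstOrder) (hne : (herbrandUniverse Sg).Nonempty) {K : HForm C}
    (hK : K.AtomsProductive Sg) {G A : Tm C} (hGA : K.HasInstance (G.mkImp A))
    (hg : AtomsGuarded Sg' [] (G.mkImp A)) :
    A.Rigid ∧ ConjAll (fun _ => True) G ∧
      ∀ J : Set (LTree C), ConjAll (fun B => B.val ρ ∈ J) G →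
        ∃ b ⊆ J, TreeInstance Sg K b (A.val ρ) ∧ A.val ρ ∈ herbrandBase Sg := by
  rcases hGA.cases_of_head_ne_all hK with ⟨D', hD⟩ |
    ⟨s, ⟨-, -, hD⟩ | ⟨B, Bs, G', A', hb, hD, hG, hA, hA'⟩⟩
  · cases hD
  · exact absurd rfl (Tm.head_ne_log (.inl hD))
  · cases hD
    have hrigid : ∀ A ∈ B :: Bs, A.Rigid := fun A hA =>
      (hK A (List.mem_cons_of_mem _ (hb ▸ hA))).1
    have hconj : ConjAll (fun _ => True) G :=
      .of_forall_mem (fun _ _ _ h => h) hrigid hG fun _ _ => trivial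
    obtain ⟨hgG, hgA⟩ := hg.of_mkImp
    have hprod := GuardedAtom.productiveAtom (h.firstOrder hSg) (n := 0)
      (hgA.guardedAtom (.inl hA'))
    refine ⟨hA', hconj, fun J hJ => ⟨{T | ∃ A ∈ K.body, T = (A.subst s).val ρ}, ?_, ?_,
      h.val_mem_herbrandBase hprod⟩⟩
    · rintro _ ⟨R, hR, rfl⟩
      refine hJ.forall_mem (s := s) (fun R R' hRR hR' => ?_) hrigid hG R (hb ▸ hR)
      rw [Tm.val_congr hRR.fixBetaEq]
      exact hR'
    · rw [← Tm.val_congr hA.fixBetaEq]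
      refine h.treeInstance hne hK fun R hR => ?_
      rcases List.mem_cons.1 hR with rfl | hR
      · exact hprod.of_fixBetaEq hA.fixBetaEq
      · exact (hconj.productiveAtom (h.firstOrder hSg) hgG).forall_mem
          (fun R R' hRR hR' => hR'.of_fixBetaEq hRR.fixBetaEq) hrigid hG R (hb ▸ hR)

end Instances

/-! ### Soundness of the unmarked rules -/

theorem InitialEq.fixBetaEq {L : Calculus} {A A' : Tm C} (h : InitialEq L A A') :
    FixBetaEq A A' := by
  cases L
  · exact h ▸ .refl _
  · exact h
  · exact h ▸ .refl _
  · exact h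

/-- The clauses which occur in a proof: conjunctions of atoms with values in `J`, and instances of
`H`-formulae in `Ks`. -/
def SoundClause (Ks : Set (HForm C)) (ρ : C → Option (LTree C)) (J : Set (LTree C))
    (D : Tm C) : Prop :=
  ConjAll (fun A => A.val ρ ∈ J) D ∨ ∃ K ∈ Ks, K.HasInstance D

/-- Let `J` be closed under the tree-form ground instances of the `H`-formulae in `Ks`. If all
clauses to the left of the arrow are conjunctions of atoms with values in `J` and instances of
formulae in `Ks`, then the values of all provable atoms are in `J`. All goals that arise are
conjunctions of atoms, so the signature and the left-hand side stay the same throughout. -/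
theorem ProofIn.sound {Sg Sg' : Sig C} {ρ : C → Option (LTree C)}
    (hρ : EigenExtension Sg Sg' ρ) (hSg : Sg.FirstOrder) (hne : (herbrandUniverse Sg).Nonempty)
    {Ks : Set (HForm C)} (hKs : ∀ K ∈ Ks, K.AtomsProductive Sg) {J : Set (LTree C)}
    (hJ : ∀ K ∈ Ks, ∀ b T, TreeInstance Sg K b T → T ∈ herbrandBase Sg → b ⊆ J → T ∈ J)
    {P H : Set (Tm C)} (hPH : ∀ D ∈ P ∪ H, SoundClause Ks ρ J D) {L : Calculus} {q : Sequent C}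
    (h : ProofIn L Sequent.Guarded q) :
    (∀ G, q = .right Sg' P H G → ConjAll (fun _ => True) G → ConjAll (fun A => A.val ρ ∈ J) G) ∧
      ∀ D A, q = .left Sg' P H D A → SoundClause Ks ρ J D → A.val ρ ∈ J := by
  induction h with
  | node rule lang prop premises ih =>
    constructor
    · rintro G rfl hG
      cases rule with
      | impR => cases hG.head_of_head_eq_log rfl
      | allR => cases hG.head_of_head_eq_log rfl
      | exR => cases hG.head_of_head_eq_log rfl
      | orR₁ => cases hG.head_of_head_eq_log rfl
      | orR₂ => cases hG.head_of_head_eq_log rfl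
      | topR => cases hG.head_of_head_eq_log rfl
      | andR _ _ _ G₁ G₂ =>
        exact .and ((ih (.right Sg' P H G₁) (by simp)).1 _ rfl hG.of_mkAnd.1)
          ((ih (.right Sg' P H G₂) (by simp)).1 _ rfl hG.of_mkAnd.2)
      | decide _ _ _ D _ hA hD =>
        have hval := (ih (.left Sg' P H D G) (by simp)).2 _ _ rfl (hPH D hD)
        cases hG with
        | atom hG _ => exact .atom hG hval
        | and _ _ => exact absurd rfl (Tm.head_ne_log hA.2)
    · rintro D A rfl hD
      cases rule with
      | impL _ _ _ G D _ =>
        rcases hD with hD | ⟨K, hK, hD⟩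
        · cases hD.head_of_head_eq_log rfl
        · have hg : AtomsGuarded Sg' [] (G.mkImp D) := prop.1 _ (Set.mem_insert _ _)
          obtain ⟨hr, hG, himp⟩ := hρ.treeInstance_of_imp hSg hne (hKs K hK) hD hg
          obtain ⟨b, hb, hT, hbase⟩ :=
            himp J ((ih (.right Sg' P H G) (by simp)).1 _ rfl hG)
          exact (ih (.left Sg' P H D A) (by simp)).2 _ _ rfl
            (.inl (.atom hr (hJ K hK b _ hT hbase hb)))
      | andL₁ _ _ _ D₁ D₂ _ =>
        rcases hD with hD | ⟨K, hK, hD⟩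
        · exact (ih (.left Sg' P H D₁ A) (by simp)).2 _ _ rfl (.inl hD.of_mkAnd.1)
        · exact absurd hD (HForm.HasInstance.not_mkAnd (hKs K hK))
      | andL₂ _ _ _ D₁ D₂ _ =>
        rcases hD with hD | ⟨K, hK, hD⟩
        · exact (ih (.left Sg' P H D₂ A) (by simp)).2 _ _ rfl (.inl hD.of_mkAnd.2)
        · exact absurd hD (HForm.HasInstance.not_mkAnd (hKs K hK))
      | allL _ _ _ t D N D' _ hN hD' =>
        rcases hD with hD | ⟨K, hK, hD⟩
        · cases hD.head_of_head_eq_log rfl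
        · exact (ih (.left Sg' P H D' A) (by simp)).2 _ _ rfl
            (.inr ⟨K, hK, hD.of_mkAll (hKs K hK) (.of_beta hD'.1)⟩)
      | initial _ _ _ _ _ hA hA' heq =>
        rw [Tm.val_congr heq.fixBetaEq]
        rcases hD with hD | ⟨K, hK, hD⟩
        · exact hD.of_atomic hA'.2
        · obtain ⟨hT, hbase⟩ := hρ.treeInstance_of_atom hSg hne (hKs K hK) hD hA'.2
            (prop.1 _ (Set.mem_insert _ _))
          exact hJ K hK _ _ hT hbase (Set.empty_subset J)

/-! ### Soundness of the rules for guarded goals -/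

/-- An atom above the arrow can only be used by the rule `initial`. -/
theorem ProofIn.fixBetaEq_of_left_atom {Q : Sequent C → Prop} {L : Calculus} {Sg : Sig C}
    {P H : Set (Tm C)} {D A : Tm C} (hD : D.Rigid) (h : ProofIn L Q (.left Sg P H D A)) :
    FixBetaEq A D := by
  have hlog := fun l => Tm.head_ne_log (.inl hD) (l := l)
  cases h with
  | node rule lang prop premises =>
    cases rule with
    | initial _ _ _ _ _ hA hA' heq => exact heq.fixBetaEq
    | _ => exact absurd rfl (hlog _)

section Marked

variable {Sg Sg' : Sig C} {ρ : C → Option (LTree C)} {P : Set (HForm C)} {Ks : Set (HForm C)}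
  {J : Set (LTree C)}

/-- Decomposition of a clause of the original program: a marked atom is the head of an instance of
that clause whose body is proved by the unmarked rules. -/
theorem ProofIn.val_mem_consequence_of_leftG
    (hρ : EigenExtension Sg Sg' ρ) (hSg : Sg.FirstOrder) (hne : (herbrandUniverse Sg).Nonempty)
    (hKs : ∀ K ∈ Ks, K.AtomsProductive Sg)
    (hJ : ∀ K ∈ Ks, ∀ b T, TreeInstance Sg K b T → T ∈ herbrandBase Sg → b ⊆ J → T ∈ J)
    {P' H : Set (Tm C)} (hPH : ∀ D ∈ P' ∪ H, SoundClause Ks ρ J D) {L : Calculus}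
    {K : HForm C} (hK : K ∈ Ks) (hKP : K ∈ P) {q : Sequent C}
    (h : ProofIn L Sequent.Guarded q) :
    ∀ D A, q = .leftG Sg' P' H D A → K.HasInstance D → A.val ρ ∈ consequence Sg P J := by
  induction h with
  | node rule lang prop premises ih =>
    rintro D A rfl hD
    cases rule with
    | impLG _ _ _ G D _ =>
      have hg : AtomsGuarded Sg' [] (G.mkImp D) := prop.1 _ (Set.mem_insert _ _)
      obtain ⟨hr, hG, himp⟩ := hρ.treeInstance_of_imp hSg hne (hKs K hK) hD hg
      have hp := premises (.right Sg' P' H G) (by simp)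
      obtain ⟨b, hb, hT, hbase⟩ :=
        himp J ((hp.sound hρ hSg hne hKs hJ hPH).1 _ rfl hG)
      rw [Tm.val_congr ((premises (.left Sg' P' H D A) (by simp)).fixBetaEq_of_left_atom hr)]
      exact ⟨hbase, K, hKP, b, hT, hb⟩
    | andLG₁ => exact absurd hD (HForm.HasInstance.not_mkAnd (hKs K hK))
    | andLG₂ => exact absurd hD (HForm.HasInstance.not_mkAnd (hKs K hK))
    | allLG _ _ _ t D N D' _ hN hD' =>
      exact ih (.leftG Sg' P' H D' A) (by simp) _ _ rfl (hD.of_mkAll (hKs K hK) (.of_beta hD'.1))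
    | initialG _ _ _ _ _ hA hA' heq =>
      obtain ⟨hT, hbase⟩ := hρ.treeInstance_of_atom hSg hne (hKs K hK) hD hA'.2
        (prop.1 _ (Set.mem_insert _ _))
      rw [Tm.val_congr heq.fixBetaEq]
      exact ⟨hbase, K, hKP, ∅, hT, Set.empty_subset J⟩

/-- A marked atom can only be proved by a clause of the original program. -/
theorem ProofIn.val_mem_consequence_of_rightG
    (hρ : EigenExtension Sg Sg' ρ) (hSg : Sg.FirstOrder) (hne : (herbrandUniverse Sg).Nonempty)
    (hKs : ∀ K ∈ Ks, K.AtomsProductive Sg) (hP : P ⊆ Ks)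
    (hJ : ∀ K ∈ Ks, ∀ b T, TreeInstance Sg K b T → T ∈ herbrandBase Sg → b ⊆ J → T ∈ J)
    {H : Set (Tm C)} (hPH : ∀ D ∈ HForm.formula '' P ∪ H, SoundClause Ks ρ J D) {L : Calculus}
    {A : Tm C} (hA : A.Rigid)
    (h : ProofIn L Sequent.Guarded (.rightG Sg' (HForm.formula '' P) H A)) :
    A.val ρ ∈ consequence Sg P J := by
  have hlog := fun l => Tm.head_ne_log (.inl hA) (l := l)
  cases h with
  | node rule lang prop premises =>
    cases rule with
    | decideG _ _ _ D _ _ hD =>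
      obtain ⟨K, hK, rfl⟩ := hD
      exact (premises (.leftG Sg' _ H K.formula A) (by simp)).val_mem_consequence_of_leftG hρ hSg
        hne hKs hJ hPH (hP hK) hK _ _ rfl K.hasInstance_formula
    | _ => exact absurd rfl (hlog _)

/-- The marked part of a proof of an `H`-formula `K`, read with the trees `σ` for the
eigenconstants: the head of the instance of `K` by `σ` is an immediate consequence of `J` if the
body is in `J`. While `k` quantifiers remain, `s j` is the eigenconstant that has been introduced
for the variable of index `j + k` of the matrix. -/
theorem ProofIn.tree_subst_mem_consequence (hSg : Sg.FirstOrder)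
    (hne : (herbrandUniverse Sg).Nonempty)
    (hKs : ∀ K ∈ Ks, K.AtomsProductive Sg) (hP : P ⊆ Ks)
    (hJ : ∀ K ∈ Ks, ∀ b T, TreeInstance Sg K b T → T ∈ herbrandBase Sg → b ⊆ J → T ∈ J)
    {K : HForm C} (hK : K ∈ Ks) {σ : ℕ → LTree C}
    (hσ : ∀ i < K.vars, σ i ∈ herbrandUniverse Sg)
    (hbody : ∀ A ∈ K.body, A.tree.subst σ ∈ J) {L : Calculus} {k : ℕ} (hk : k ≤ K.vars) :
    ∀ {Sg' : Sig C} {ρ : C → Option (LTree C)} {s : ℕ → Tm C}, EigenExtension Sg Sg' ρ →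
      (∀ j, j + k < K.vars → ∃ c, s j = .con c ∧ ρ c = some (σ (j + k))) →
      ProofIn L Sequent.Guarded (.rightG Sg' (HForm.formula '' P) {K.formula}
        ((Tm.mkAll .iota)^[k] (K.matrix.subst (Tm.liftSub^[k] s)))) →
      K.head.tree.subst σ ∈ consequence Sg P J := by
  induction k with
  | zero =>
    intro Sg' ρ s hρ hs h
    have hval : ∀ A ∈ K.head :: K.body, ProductiveAtom Sg' 0 (A.subst s) →
        A.tree.subst σ = (A.subst s).val ρ := fun A hA hA' => by
      refine hρ.tree_subst_eq_val_of_atom (fun j hj _ => ?_) (hKs K hK A hA).2 hA'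
      obtain ⟨c, hc, hc'⟩ := hs j hj
      rw [hc]
      exact (Tm.val_apps_con_of_some hc' []).symm
    have hclause : ∀ D ∈ HForm.formula '' P ∪ {K.formula}, SoundClause Ks ρ J D := by
      rintro D (⟨K', hK', rfl⟩ | rfl)
      · exact .inr ⟨K', hP hK', K'.hasInstance_formula⟩
      · exact .inr ⟨K, hK, K.hasInstance_formula⟩
    have hhead : (K.head.subst s).Rigid := (hKs K hK _ List.mem_cons_self).1.subst s
    have hprod : AtomsGuarded Sg' [] (K.head.subst s) → ProductiveAtom Sg' 0 (K.head.subst s) :=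
      fun hg => GuardedAtom.productiveAtom (hρ.firstOrder hSg) (n := 0)
        (hg.guardedAtom (.inl hhead))
    simp only [Function.iterate_zero, id] at h
    unfold HForm.matrix at h
    cases hb : K.body with
    | nil =>
      rw [hb] at h
      have hg : AtomsGuarded Sg' [] (K.head.subst s) := by
        cases h with
        | node _ _ prop _ => exact prop.2
      rw [hval _ List.mem_cons_self (hprod hg)]
      exact h.val_mem_consequence_of_rightG hρ hSg hne hKs hP hJ hclause hhead
    | cons B Bs =>
      rw [hb] at h
      change ProofIn L Sequent.Guarded (.rightG Sg' _ _
        (((HForm.conj B Bs).subst s).mkImp (K.head.subst s))) at h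
      cases h with
      | node rule lang prop premises =>
        have hg := AtomsGuarded.of_mkImp prop.2
        cases rule with
        | decideG _ _ _ D _ hA _ => exact absurd rfl (Tm.head_ne_log hA.2)
        | impRG =>
          have hrigid : ∀ A ∈ B :: Bs, A.Rigid := fun A hA =>
            (hKs K hK A (List.mem_cons_of_mem _ (hb ▸ hA))).1
          rw [hval _ List.mem_cons_self (hprod hg.2)]
          refine (premises _ (List.mem_singleton.2 rfl)).val_mem_consequence_of_rightG hρ hSg hne
            hKs hP hJ ?_ hhead
          have hconj : ConjAll (fun A => A.val ρ ∈ J) ((HForm.conj B Bs).subst s) := by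
            have hguard : ∀ A ∈ B :: Bs, ProductiveAtom Sg' 0 (A.subst s) := by
              refine ConjAll.forall_mem (fun R R' hR hR' => hR'.of_fixBetaEq hR.fixBetaEq) hrigid
                (.refl _) (ConjAll.productiveAtom (p := fun _ => True) (hρ.firstOrder hSg)
                  (.of_forall_mem (fun _ _ _ h => h) hrigid (.refl _) fun _ _ => trivial) hg.1)
            refine .of_forall_mem (fun R R' hR hR' => ?_) hrigid (.refl _) fun A hA => ?_
            · rwa [← Tm.val_congr hR.fixBetaEq]
            · have hA' := hb ▸ hA
              rw [← hval A (List.mem_cons_of_mem _ hA') (hguard A hA)]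
              exact hbody A hA'
          rintro D (hD | hD | hD)
          · exact hclause D (.inl hD)
          · exact .inl (hD ▸ hconj)
          · exact hclause D (.inr hD)
  | succ k ih =>
    intro Sg' ρ s hρ hs h
    rw [Function.iterate_succ_apply'] at h
    cases h with
    | node rule lang prop premises =>
      cases rule with
      | decideG _ _ _ D _ hA _ => exact absurd rfl (Tm.head_ne_log hA.2)
      | allRG _ _ _ _ _ c hc =>
        classical
        have hp := premises _ (List.mem_singleton.2 rfl)
        rw [Tm.inst, Tm.subst_mkAlls, Tm.subst_iterate_inst] at hp
        refine ih (Nat.le_of_succ_le hk) (hρ.extend hc (hσ k hk)) (fun j hj => ?_) hp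
        cases j with
        | zero => exact ⟨c, rfl, by simp⟩
        | succ j =>
          obtain ⟨d, hd, hd'⟩ := hs j (by omega)
          -- The eigenconstant `c` is fresh, so it does not overwrite an earlier one.
          have hdc : d ≠ c := by
            rintro rfl
            rcases hρ d with ⟨h, -⟩ | ⟨_, -, -, -, h⟩
            · rw [h] at hd'; cases hd'
            · rw [hc] at h; cases h
          exact ⟨d, hd, by rw [Function.update_of_ne hdc, hd']; congr 2; omega⟩

end Marked

/-! ### The coinductive argument -/

/-- The closure of the coinductive model of `P` under the tree-form ground instances of the
`H`-formulae in `Ks`. -/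
inductive ModelClosure (Sg : Sig C) (P Ks : Set (HForm C)) : LTree C → Prop
  | model {T : LTree C} : T ∈ coinductiveModel Sg P → ModelClosure Sg P Ks T
  | step {T : LTree C} (K : HForm C) (hK : K ∈ Ks) (b : Set (LTree C))
      (hT : TreeInstance Sg K b T) (hbase : T ∈ herbrandBase Sg)
      (hb : ∀ B ∈ b, ModelClosure Sg P Ks B) : ModelClosure Sg P Ks T

end CoUP

theorem mainTheorem1 {C : Type*} (Sg : CoUP.Sig C) (hSg : Sg.FirstOrder)
    (hne : (CoUP.herbrandUniverse Sg).Nonempty)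
    (P : Set (CoUP.HForm C)) (hP : CoUP.IsLogicProgram Sg P)
    (K : CoUP.HForm C) (hK : K.IsHFormula Sg)
    (L : CoUP.Calculus)
    (hproof : CoUP.ProofIn L CoUP.Sequent.Guarded
      (CoUP.Sequent.coind Sg (CoUP.HForm.formula '' P) K.formula))
    (body' : Set (CoUP.LTree C)) (head' : CoUP.LTree C)
    (hinst : CoUP.TreeInstance Sg K body' head')
    (hbody : body' ⊆ CoUP.coinductiveModel Sg P) :
    head' ∈ CoUP.coinductiveModel Sg P := by
  open CoUP in
  cases hproof with
  | node rule lang prop premises =>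
  cases rule with
  | cofix =>
  have hKs : ∀ K' ∈ insert K P, K'.AtomsProductive Sg := by
    rintro K' (rfl | hK')
    · exact hK.atomsProductive hSg prop.2
    · exact (hP.2 K' hK').atomsProductive hSg (prop.1 _ ⟨K', hK', rfl⟩)
  set J : Set (LTree C) := {T | ModelClosure Sg P (insert K P) T}
  have hstep : ∀ b T, TreeInstance Sg K b T → b ⊆ J → T ∈ consequence Sg P J := by
    rintro b T ⟨σ, hσ, rfl, rfl⟩ hb
    refine ProofIn.tree_subst_mem_consequence (Ks := insert K P) (J := J) (L := L) hSg hne hKs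
      (Set.subset_insert K P)
      (fun K' hK' b T hT hbase hb => ModelClosure.step K' hK' b hT hbase hb)
      (Set.mem_insert K P) hσ (fun A hA => hb ⟨A, hA, rfl⟩) le_rfl (s := .var) (.refl Sg)
      (fun j hj => absurd hj (by omega)) ?_
    rw [Tm.iterate_liftSub_var, Tm.subst_var]
    exact premises _ (List.mem_singleton.2 rfl)
  -- `J` is post-fixed: an instance of `K` with body in `J` is rederived from `P` by `hproof`.
  have hpost : J ≤ consequence Sg P J := by
    rintro T (hT | ⟨K', hK', b, hT, hbase, hb⟩)
    · have hT' : T ∈ consequence Sg P (coinductiveModel Sg P) := by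
        rw [coinductiveModel, (consequence Sg P).map_gfp]
        exact hT
      exact (consequence Sg P).monotone (fun T hT => ModelClosure.model hT) hT'
    · rcases hK' with rfl | hK'
      · exact hstep b T hT hb
      · exact ⟨hbase, K', hK', b, hT, hb⟩
  have hle : consequence Sg P J ≤ coinductiveModel Sg P :=
    (consequence Sg P).le_gfp ((consequence Sg P).monotone hpost)
  exact hle (hstep body' head' hinst fun B hB => .model (hbody hB))
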